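/- **Definitions.** A *disk* of the extended plane $\widehat{\mathbb R^2}=\mathbb R^2\cup\{\infty\}$ is a closed round disk of radius $r>0$ (curvature $1/r$), the closed exterior of a circle of radius $r$ together with $\infty$ (curvature $-1/r$), or a closed half-plane together with $\infty$ (curvature $0$). Two disks are *tangent* if they have exactly one common point. The *Möbius group* is generated by the inversions in circles and the reflections in lines. A convex polyhedron $P\subset\mathbb R^3$ containing the origin in its interior is *edge-scribed* if its vertices lie outside the unit sphere $\mathbb S^2$ and all its edges are tangent to $\mathbb S^2$. Its *ball-arrangement projection* $\mathsf B(P)$ is the collection of disks obtained by projecting stereographically, for each vertex $v$ of $P$, the cap $\{u\in\mathbb S^2:\langle u,v\rangle\ge 1\}$. An *octahedral* (respectively *cubical*) *disk packing* is a collection $\mathcal B=\mu(\mathsf B(P))$, where $\mu$ is a Möbius transformation and $P$ is an edge-scribed polyhedron combinatorially equivalent to the octahedron (respectively the cube). Its *dual* is $\mathcal B^*=\mu(\mathsf B(P^*))$ with $P^*$ the polar of $P$; its *Apollonian group* is generated by the inversions in the boundaries of the disks of $\mathcal B^*$; and its *Apollonian packing* $\Omega(\mathcal B)$ is the orbit of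 $\mathcal B$ under this group. $\Omega(\mathcal B)$ is *integral* if all its disks have integer curvature. Finally put $$\mathfrak T_2(x,y,z)=\tfrac12\big((x+y+z)^2-x^2-y^2-z^2\big),\qquad \mathfrak C_2(x,y,z)=\tfrac14\big((x+z)^2-(x-y)^2-(y-z)^2\big).$$ **Proposition.** 1. Let $\kappa_1,\kappa_2,\kappa_3$ be the curvatures of three pairwise tangent disks of an octahedral disk packing $\mathcal B$. Then $\mathfrak T_2(\kappa_1,\kappa_2,\kappa_3)\ge 0$, and $\Omega(\mathcal B)$ is integral if and only if $\kappa_1,\kappa_2,\kappa_3$ and $\sqrt{2\,\mathfrak T_2(\kappa_1,\kappa_2,\kappa_3)}$ are integers. 2. Let $\kappa_1,\kappa_2,\kappa_3$ be the curvatures of three consecutive tangent disks $b_1,b_2,b_3$ of a cubical disk packing $\mathcal B$ (that is, $b_1\ne b_3$, and $b_2$ is tangent to both $b_1$ and $b_3$). Then $\mathfrak C_2(\kappa_1,\kappa_2,\kappa_3)\ge 0$, and $\Omega(\mathcal B)$ is integral if and only if $\kappa_1,\kappa_2,\kappa_3$ and $\sqrt{2\,\mathfrak C_2(\kappa_1,\kappa_2,\kappa_3)}$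 are integers. -/

import Mathlib

noncomputable section

namespace ApollonianPacking

/-- The Euclidean plane. -/
abbrev Plane : Type := EuclideanSpace ℝ (Fin 2)

/-- Euclidean three-space. -/
abbrev Space : Type := EuclideanSpace ℝ (Fin 3)

/-- The extended plane `ℝ² ∪ {∞}`. -/
abbrev ExtPlane : Type := OnePoint Plane

/-! ### Disks of the extended plane, curvature, tangency -/

/-- A disk of the extended plane: a closed round disk, the closed exterior of a circle,
or a closed half-plane (given by its outer unit normal `n`). -/
inductive Disk : Type
  | ball (c : Plane) (r : ℝ) (hr : 0 < r) : Disk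
  | exterior (c : Plane) (r : ℝ) (hr : 0 < r) : Disk
  | halfPlane (n : Plane) (hn : ‖n‖ = 1) (a : ℝ) : Disk

/-- The set of points of a disk. Exteriors and half-planes contain `∞`. -/
def Disk.carrier : Disk → Set ExtPlane
  | .ball c r _ => (fun x : Plane => (x : ExtPlane)) '' {x | dist x c ≤ r}
  | .exterior c r _ => insert OnePoint.infty ((fun x : Plane => (x : ExtPlane)) '' {x | r ≤ dist x c})
  | .halfPlane n _ a => insert OnePoint.infty ((fun x : Plane => (x : ExtPlane)) '' {x | inner ℝ n x ≤ a})

/-- The (signed) curvature of a disk. -/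
def Disk.curvature : Disk → ℝ
  | .ball _ r _ => 1 / r
  | .exterior _ r _ => -(1 / r)
  | .halfPlane _ _ _ => 0

/-- Two disks are (externally) tangent when they have exactly one common point. -/
def Tangent (D E : Disk) : Prop := ∃ p : ExtPlane, D.carrier ∩ E.carrier = {p}

/-! ### Inversions and Möbius transformations -/

open Classical in
/-- Inversion of the extended plane in the circle of centre `c` and radius `r`,
exchanging `c` and `∞`. -/
def circleInversionFun (c : Plane) (r : ℝ) : ExtPlane → ExtPlane
  | none => (c : ExtPlane)
  | some x => if x = c then OnePoint.infty else (EuclideanGeometry.inversion c r x : Plane)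

/-- Reflection of the extended plane in the line `⟪n, x⟫ = a` (with `n` a unit vector), fixing `∞`. -/
def lineReflectionFun (n : Plane) (a : ℝ) : ExtPlane → ExtPlane
  | none => OnePoint.infty
  | some x => (x - (2 * (inner ℝ n x - a)) • n : Plane)

theorem circleInversionFun_involutive (c : Plane) {r : ℝ} (hr : 0 < r) :
    Function.Involutive (circleInversionFun c r) := by
  intro p
  rcases p with _ | x
  · change (if c = c then OnePoint.infty else _) = _
    rw [if_pos rfl]
    rfl
  · by_cases hx : x = c
    · change circleInversionFun c r (if x = c then OnePoint.infty else _) = _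
      rw [if_pos hx, hx]
      rfl
    · change circleInversionFun c r (if x = c then OnePoint.infty else _) = _
      rw [if_neg hx]
      change (if EuclideanGeometry.inversion c r x = c then OnePoint.infty else _) = _
      rw [if_neg (by rwa [EuclideanGeometry.inversion_eq_center hr.ne']),
        EuclideanGeometry.inversion_inversion c hr.ne']
      rfl

theorem lineReflectionFun_involutive {n : Plane} (hn : ‖n‖ = 1) (a : ℝ) :
    Function.Involutive (lineReflectionFun n a) := by
  intro p
  rcases p with _ | x
  · rfl
  · change ((_ : Plane) : ExtPlane) = ((x : Plane) : ExtPlane)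
    congr 1
    have h : inner ℝ n n = (1 : ℝ) := by rw [real_inner_self_eq_norm_sq, hn]; norm_num
    rw [inner_sub_right, inner_smul_right, h]
    module

/-- The inversion in the boundary circle (or line) of a disk, as a permutation of the
extended plane. -/
def Disk.inversion : Disk → Equiv.Perm ExtPlane
  | .ball c _ hr => (circleInversionFun_involutive c hr).toPerm
  | .exterior c _ hr => (circleInversionFun_involutive c hr).toPerm
  | .halfPlane _ hn a => (lineReflectionFun_involutive hn a).toPerm

/-- The Möbius group of the extended plane, generated by all inversions. -/
def moebiusGroup : Subgroup (Equiv.Perm ExtPlane) :=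
  Subgroup.closure (Set.range Disk.inversion)

/-! ### Edge-scribed polyhedra -/

/-- The vertices of a convex polytope. -/
abbrev vertices (P : Set Space) : Set Space := P.extremePoints ℝ

/-- Two convex polytopes are combinatorially equivalent: there is a bijection between their
vertices under which the vertex sets of faces correspond to the vertex sets of faces. -/
def CombEquiv (P Q : Set Space) : Prop :=
  ∃ φ : vertices P ≃ vertices Q, ∀ A : Set (vertices P),
    IsExposed ℝ P (convexHull ℝ (Subtype.val '' A)) ↔
      IsExposed ℝ Q (convexHull ℝ (Subtype.val '' (φ '' A)))

/-- `v` and `w` are the end points of an edge of `P`. -/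
def IsEdge (P : Set Space) (v w : Space) : Prop :=
  v ∈ vertices P ∧ w ∈ vertices P ∧ v ≠ w ∧ IsExposed ℝ P (segment ℝ v w)

/-- `P` is an edge-scribed convex polyhedron: its vertices lie outside the unit sphere and every
edge is tangent to the unit sphere. The origin lies in the interior, so that the polar of `P` is
again a polyhedron. -/
structure IsEdgeScribed (P : Set Space) : Prop where
  polytope : ∃ S : Set Space, S.Finite ∧ P = convexHull ℝ S
  zero_mem : (0 : Space) ∈ interior P
  outside : ∀ v ∈ vertices P, 1 < ‖v‖
  tangent : ∀ v w, IsEdge P v w →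
    (∃ p ∈ segment ℝ v w, ‖p‖ = 1) ∧ ∀ q ∈ affineSpan ℝ {v, w}, 1 ≤ ‖q‖

/-- The polar of `P`. -/
def polar (P : Set Space) : Set Space := {u | ∀ x ∈ P, inner ℝ x u ≤ 1}

/-- The regular octahedron with vertices `±eᵢ`. -/
def octahedron : Set Space :=
  convexHull ℝ {x | ∃ i : Fin 3, x = EuclideanSpace.single i 1 ∨ x = EuclideanSpace.single i (-1)}

/-- The cube with vertices `(±1, ±1, ±1)`. -/
def cube : Set Space := convexHull ℝ {x | ∀ i : Fin 3, x i = 1 ∨ x i = -1}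

/-! ### Polytopal disk packings and their Apollonian packings -/

open Classical in
/-- Stereographic projection of the unit sphere from the north pole `(0, 0, 1)`. -/
def stereo (u : Space) : ExtPlane :=
  if u 2 = 1 then OnePoint.infty else (!₂[u 0 / (1 - u 2), u 1 / (1 - u 2)] : Plane)

/-- The part of the unit sphere illuminated by a light source at `v`. -/
def illuminated (v : Space) : Set Space := {u | ‖u‖ = 1 ∧ 1 ≤ inner ℝ u v}

/-- The ball-arrangement projection of `P`. -/
def ballArrangement (P : Set Space) : Set Disk :=
  {D | ∃ v ∈ vertices P, D.carrier = stereo '' illuminated v}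

/-- The image of a collection of disks under a transformation of the extended plane. -/
def imageDisks (g : Equiv.Perm ExtPlane) (B : Set Disk) : Set Disk :=
  {D | ∃ E ∈ B, D.carrier = g '' E.carrier}

/-- The polytopal disk packing `μ(B(P))` with tangency polytope `P`. -/
def packing (P : Set Space) (μ : Equiv.Perm ExtPlane) : Set Disk :=
  imageDisks μ (ballArrangement P)

/-- The dual `μ(B(P*))` of the packing `μ(B(P))`. -/
def dualPacking (P : Set Space) (μ : Equiv.Perm ExtPlane) : Set Disk :=
  imageDisks μ (ballArrangement (polar P))

/-- The Apollonian group of the packing `μ(B(P))`, generated by the inversions in the dual disks. -/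
def apollonianGroup (P : Set Space) (μ : Equiv.Perm ExtPlane) : Subgroup (Equiv.Perm ExtPlane) :=
  Subgroup.closure (Disk.inversion '' dualPacking P μ)

/-- The Apollonian packing of `μ(B(P))`: the orbit of the packing under its Apollonian group. -/
def apollonianPacking (P : Set Space) (μ : Equiv.Perm ExtPlane) : Set Disk :=
  {D | ∃ g ∈ apollonianGroup P μ, D ∈ imageDisks g (packing P μ)}

/-- The real number `x` is an integer. -/
def IsInt (x : ℝ) : Prop := ∃ m : ℤ, x = m

/-- A collection of disks is integral when all its curvatures are integers. -/
def IntegralDisks (B : Set Disk) : Prop := ∀ D ∈ B, IsInt D.curvature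

/-! ### The quadratic forms -/

/-- The simplicial quadratic form `𝔗_{d+1}` in `d + 2` variables (`d ≥ 1`). -/
def simplicialForm (d : ℕ) (u : Fin (d + 2) → ℝ) : ℝ :=
  1 / 2 * (1 / (d : ℝ) * (∑ i, u i) ^ 2 - ∑ i, u i ^ 2)

/-- The hypercubical quadratic form `ℭ_{d+1}` in `d + 2` variables (`d ≥ 1`). -/
def hypercubicalForm (d : ℕ) (u : Fin (d + 2) → ℝ) : ℝ :=
  1 / 4 * (1 / (d : ℝ) * (u 0 + u (Fin.last (d + 1))) ^ 2
    - ∑ i : Fin (d + 1), (u i.castSucc - u i.succ) ^ 2)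

/-- `𝔗₂(κ₁, κ₂, κ₃)`. -/
def T₂ (k₁ k₂ k₃ : ℝ) : ℝ := simplicialForm 1 ![k₁, k₂, k₃]

/-- `ℭ₂(κ₁, κ₂, κ₃)`. -/
def C₂ (k₁ k₂ k₃ : ℝ) : ℝ := hypercubicalForm 1 ![k₁, k₂, k₃]

end ApollonianPacking

end

open ApollonianPacking

noncomputable section

namespace ApollonianPacking

/-! A disk is a vector of norm one in Lorentz four-space: the function `circleEval` is nonpositive
exactly on the disk, and its coordinate `x 0` is the curvature. Inversion in a disk acts as the
Lorentz reflection in its vector, so every Möbius map acts by a linear isometry `M`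
(`exists_induces`), and the packing is the set of vectors `M (capVec v)`. Curvature is a linear
functional, represented by a null vector.

Rigidity. An edge tangent to the sphere gives product `-1` between the caps of its ends
(`lorentz_capVec_of_tangent`). Together with the combinatorial type this determines the whole Gram
matrix. In a suitable Lorentz orthonormal frame `e 0, e 1, e 2, w` the vectors are `w ± √2 e i` for
the octahedron (`exists_octahedral_frame`) and `√2 w ± e 0 ± e 1 ± e 2` for the cube
(`exists_cubical_frame`).

Quadratic relation. Since the curvature functional κ is null, `∑ κ(e i)² = κ(w)²`. Let W be the mean
curvature of two opposite disks, that is, κ(w) for the octahedron and √2 κ(w) for the cube.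
Rewriting the relation in the three given curvatures yields `2 𝔗₂ = (W - κ₁ - κ₂ - κ₃)²` and `2 ℭ₂ =
(W - κ₁ - κ₃)²`. Both forms are therefore nonnegative, and, given integral κᵢ, the root is an
integer exactly when W is.

Integrality. If the Apollonian packing is integral, opposite disks show that 2W is an integer; the
square of the root being half an integer, a parity argument (`isInt_of_two_mul`) makes the root an
integer. Conversely, integral κᵢ and W make the whole packing integral. The central vector and the
disk vectors generate a lattice Λ with integral curvatures. The polar vertices are computed from
their tight inequalities (`octahedral_dual`, `cubical_dual`): up to scaling, each dual disk is a
vector F of Λ with norm 2 and integral products with Λ. Its reflection `x ↦ x - ⟨x, F⟩ F` preserves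
Λ, so the whole orbit stays in Λ (`integralDisks_of_generators`). -/

/-- Lorentz four-space, the space of oriented generalized circles
`x₀ |p|² - 2 (x₁ p₀ + x₂ p₁) + x₃ = 0`. -/
abbrev Lor : Type := Fin 4 → ℝ

/-- The Lorentz form. -/
def lorentz (x y : Lor) : ℝ := x 1 * y 1 + x 2 * y 2 - (x 0 * y 3 + x 3 * y 0) / 2

/-- The value at a point of the extended plane of the function defined by a Lorentz vector. -/
def circleEval (x : Lor) : ExtPlane → ℝ
  | none => x 0
  | some p => x 0 * (p 0 ^ 2 + p 1 ^ 2) - 2 * (x 1 * p 0 + x 2 * p 1) + x 3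

/-- The subset of the extended plane bounded by a generalized circle. -/
def region (x : Lor) : Set ExtPlane := {p | circleEval x p ≤ 0}

/-- The Lorentz vector of a disk. -/
def Disk.vec : Disk → Lor
  | .ball c r _ => ![1 / r, c 0 / r, c 1 / r, (c 0 ^ 2 + c 1 ^ 2 - r ^ 2) / r]
  | .exterior c r _ => -![1 / r, c 0 / r, c 1 / r, (c 0 ^ 2 + c 1 ^ 2 - r ^ 2) / r]
  | .halfPlane n _ a => ![0, -n 0, -n 1, -2 * a]

/-- The Lorentz reflection in a vector of norm one. -/
def lorentzReflection (f x : Lor) : Lor := x - (2 * lorentz x f) • f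

/-! ### Algebra of the Lorentz form -/

theorem lorentz_comm (x y : Lor) : lorentz x y = lorentz y x := by
  simp only [lorentz]; ring

theorem lorentz_add_left (x y z : Lor) : lorentz (x + y) z = lorentz x z + lorentz y z := by
  simp only [lorentz, Pi.add_apply]; ring

theorem lorentz_add_right (x y z : Lor) : lorentz z (x + y) = lorentz z x + lorentz z y := by
  simp only [lorentz, Pi.add_apply]; ring

theorem lorentz_sub_left (x y z : Lor) : lorentz (x - y) z = lorentz x z - lorentz y z := by
  simp only [lorentz, Pi.sub_apply]; ring

theorem lorentz_sub_right (x y z : Lor) : lorentz z (x - y) = lorentz z x - lorentz z y := by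
  simp only [lorentz, Pi.sub_apply]; ring

theorem lorentz_smul_left (a : ℝ) (x z : Lor) : lorentz (a • x) z = a * lorentz x z := by
  simp only [lorentz, Pi.smul_apply, smul_eq_mul]; ring

theorem lorentz_smul_right (a : ℝ) (x z : Lor) : lorentz z (a • x) = a * lorentz z x := by
  simp only [lorentz, Pi.smul_apply, smul_eq_mul]; ring

theorem lorentz_zero_left (z : Lor) : lorentz 0 z = 0 := by
  simp [lorentz]

theorem lorentz_zero_right (z : Lor) : lorentz z 0 = 0 := by
  simp [lorentz]

theorem eq_zero_of_lorentz_eq_zero {x : Lor} (h : ∀ y, lorentz x y = 0) : x = 0 := by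
  have h0 := h ![0, 0, 0, 1]
  have h1 := h ![0, 1, 0, 0]
  have h2 := h ![0, 0, 1, 0]
  have h3 := h ![1, 0, 0, 0]
  simp [lorentz] at h0 h1 h2 h3
  ext i
  fin_cases i <;> assumption

theorem mul_nonpos_iff_of_pos {a b : ℝ} (ha : 0 < a) : a * b ≤ 0 ↔ b ≤ 0 := by
  simpa using mul_le_mul_iff_right₀ ha (b := b) (c := 0)

/-! ### Disks as Lorentz vectors of norm one -/

theorem norm_sq_plane (x : Plane) : ‖x‖ ^ 2 = x 0 ^ 2 + x 1 ^ 2 := by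
  rw [EuclideanSpace.real_norm_sq_eq, Fin.sum_univ_two]

theorem dist_sq_plane (x c : Plane) : dist x c ^ 2 = (x 0 - c 0) ^ 2 + (x 1 - c 1) ^ 2 := by
  rw [dist_eq_norm, norm_sq_plane]; simp

theorem inner_plane (x y : Plane) : inner ℝ x y = x 0 * y 0 + x 1 * y 1 := by
  simp [PiLp.inner_apply, Fin.sum_univ_two, mul_comm]

theorem Disk.lorentz_vec_self (D : Disk) : lorentz D.vec D.vec = 1 := by
  cases D with
  | ball c r hr => simp [lorentz, Disk.vec]; field_simp; ring
  | exterior c r hr => simp [lorentz, Disk.vec]; field_simp; ring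
  | halfPlane n hn a =>
    have := norm_sq_plane n
    rw [hn] at this
    simp [lorentz, Disk.vec]; linarith

theorem Disk.vec_zero (D : Disk) : D.vec 0 = D.curvature := by
  cases D <;> simp [Disk.vec, Disk.curvature]

theorem infty_mem_region {x : Lor} : OnePoint.infty ∈ region x ↔ x 0 ≤ 0 := Iff.rfl

theorem coe_mem_region {x : Lor} {p : Plane} : (p : ExtPlane) ∈ region x ↔
    x 0 * (p 0 ^ 2 + p 1 ^ 2) - 2 * (x 1 * p 0 + x 2 * p 1) + x 3 ≤ 0 := Iff.rfl

theorem Disk.infty_mem_carrier (D : Disk) : OnePoint.infty ∈ D.carrier ↔ D.curvature ≤ 0 := by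
  cases D with
  | ball c r hr => simp [Disk.carrier, Disk.curvature, hr]
  | exterior c r hr => simp [Disk.carrier, Disk.curvature, hr.le]
  | halfPlane n hn a => simp [Disk.carrier, Disk.curvature]

theorem coe_mem_ball {c x : Plane} {r : ℝ} {hr : 0 < r} :
    (x : ExtPlane) ∈ (Disk.ball c r hr).carrier ↔ dist x c ≤ r := by
  simp [Disk.carrier]

theorem coe_mem_exterior {c x : Plane} {r : ℝ} {hr : 0 < r} :
    (x : ExtPlane) ∈ (Disk.exterior c r hr).carrier ↔ r ≤ dist x c := by
  simp [Disk.carrier]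

theorem coe_mem_halfPlane {n x : Plane} {a : ℝ} {hn : ‖n‖ = 1} :
    (x : ExtPlane) ∈ (Disk.halfPlane n hn a).carrier ↔ inner ℝ n x ≤ a := by
  simp [Disk.carrier]

/-- The vector is the equation of the circle divided by the signed radius; the sign puts the disk on
the nonpositive side. -/
theorem Disk.carrier_eq_region (D : Disk) : D.carrier = region D.vec := by
  ext p
  induction p using OnePoint.rec with
  | infty => rw [D.infty_mem_carrier, infty_mem_region, D.vec_zero]
  | coe x =>
    rw [coe_mem_region]
    cases D with
    | ball c r hr =>
      rw [coe_mem_ball, ← sq_le_sq₀ dist_nonneg hr.le, dist_sq_plane]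
      simp only [Disk.vec, Matrix.cons_val]
      rw [← sub_nonpos, ← mul_nonpos_iff_of_pos (inv_pos.2 hr)]
      apply iff_of_eq; congr 1; field_simp; ring
    | exterior c r hr =>
      rw [coe_mem_exterior, ← sq_le_sq₀ hr.le dist_nonneg, dist_sq_plane]
      simp only [Disk.vec, Matrix.cons_val, Pi.neg_apply]
      rw [← sub_nonpos, ← mul_nonpos_iff_of_pos (inv_pos.2 hr)]
      apply iff_of_eq; congr 1; field_simp; ring
    | halfPlane n hn a =>
      rw [coe_mem_halfPlane, inner_plane]
      simp only [Disk.vec, Matrix.cons_val]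
      constructor <;> intro h <;> linarith

/-- The sign of the curvature `x 0` selects the kind of disk; when it is nonzero the centre is `(x
1, x 2) / x 0` and the radius `1 / |x 0|`. -/
theorem Disk.exists_vec_eq {x : Lor} (hx : lorentz x x = 1) : ∃ D : Disk, D.vec = x := by
  have hx' : x 1 ^ 2 + x 2 ^ 2 - x 0 * x 3 = 1 := by rw [← hx, lorentz]; ring
  rcases lt_trichotomy (x 0) 0 with h | h | h
  · refine ⟨.exterior !₂[x 1 / x 0, x 2 / x 0] (-(x 0)⁻¹) (by simpa using h), ?_⟩
    ext i
    have := h.ne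
    fin_cases i <;> simp [Disk.vec] <;> field_simp
    linarith
  · refine ⟨.halfPlane !₂[-x 1, -x 2] ?_ (-(x 3 / 2)), ?_⟩
    · rw [← sq_eq_sq₀ (norm_nonneg _) zero_le_one, norm_sq_plane]
      simp; rw [h] at hx'; linarith
    · ext i
      fin_cases i <;> simp [Disk.vec, h]
      ring
  · refine ⟨.ball !₂[x 1 / x 0, x 2 / x 0] (x 0)⁻¹ (by simpa using h), ?_⟩
    ext i
    have := h.ne'
    fin_cases i <;> simp [Disk.vec] <;> field_simp
    linarith

/-! ### Disks are determined by their carriers -/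

/-- Walk from `c` away from `d` by almost `r`. The mixture of open and closed balls lets the bound
serve round disks and, through complements, exteriors. -/
theorem dist_add_le_of_ball_subset {c d : Plane} {r s : ℝ} (hr : 0 < r)
    (h : ∀ x : Plane, dist x c < r → dist x d ≤ s) : dist c d + r ≤ s := by
  obtain ⟨u, hu, huc⟩ : ∃ u : Plane, ‖u‖ = 1 ∧ c - d = dist c d • u := by
    by_cases hcd : c = d
    · exact ⟨EuclideanSpace.single 0 1, by simp, by simp [hcd]⟩
    · have : ‖c - d‖ ≠ 0 := by simpa [sub_eq_zero] using hcd
      refine ⟨‖c - d‖⁻¹ • (c - d), by rw [norm_smul]; simp [this], ?_⟩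
      rw [dist_eq_norm, smul_smul, mul_inv_cancel₀ this, one_smul]
  refine le_of_forall_pos_lt_add fun ε hε => ?_
  have hδ : 0 ≤ max 0 (r - ε / 2) := le_max_left _ _
  have := h (c + (max 0 (r - ε / 2)) • u) (by
    rw [dist_eq_norm, add_sub_cancel_left, norm_smul, hu, Real.norm_of_nonneg hδ, mul_one]
    exact max_lt hr (by linarith))
  rw [dist_eq_norm, add_sub_right_comm, huc, ← add_smul, norm_smul, hu,
    Real.norm_of_nonneg (add_nonneg dist_nonneg hδ)] at this
  linarith [le_max_right 0 (r - ε / 2)]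

theorem halfPlane_subset {n m : Plane} (hn : ‖n‖ = 1) (hm : ‖m‖ = 1) {a b : ℝ}
    (h : ∀ x : Plane, inner ℝ n x ≤ a → inner ℝ m x ≤ b) : n = m ∧ a ≤ b := by
  have hnn : inner ℝ n n = (1 : ℝ) := by rw [real_inner_self_eq_norm_sq, hn]; norm_num
  have hmm : inner ℝ m m = (1 : ℝ) := by rw [real_inner_self_eq_norm_sq, hm]; norm_num
  set t : ℝ := inner ℝ n m with ht
  have htm : inner ℝ m n = t := real_inner_comm _ _
  have key : ∀ s u : ℝ, s + u * t ≤ a → s * t + u ≤ b := by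
    intro s u hsu
    have := h (s • n + u • m)
    simp only [inner_add_right, inner_smul_right, hnn, hmm, htm, ← ht, mul_one] at this
    exact this hsu
  have ht1 : t ^ 2 ≤ 1 := by
    have := abs_real_inner_le_norm n m
    rw [hn, hm, mul_one] at this
    exact (sq_le_one_iff_abs_le_one _).2 this
  have ht2 : t ^ 2 = 1 := by
    by_contra hne
    have hpos : 0 < 1 - t ^ 2 := by
      rcases ht1.lt_or_eq with h | h
      · linarith
      · exact absurd h hne
    -- If `t² < 1` the normals are independent, and this choice solves `s + u t = a`, `s t + u = b +
    -- 1`: a boundary point of the first half-plane outside the second.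
    have := key (a - ((b - a * t + 1) / (1 - t ^ 2)) * t) ((b - a * t + 1) / (1 - t ^ 2)) (by linarith)
    have e : (a - ((b - a * t + 1) / (1 - t ^ 2)) * t) * t + ((b - a * t + 1) / (1 - t ^ 2))
        = b + 1 := by field_simp; ring
    linarith
  have ht3 : t = 1 := by
    rcases mul_self_eq_one_iff.1 ((sq t).symm.trans ht2) with h | h
    · exact h
    · exfalso
      have := key (-(|a| + |b| + 1)) 0 (by linarith [neg_abs_le a, abs_nonneg b])
      rw [h] at this
      linarith [le_abs_self b, abs_nonneg a]
  refine ⟨(inner_eq_one_iff_of_norm_eq_one hn hm).1 ht3, ?_⟩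
  have := key a 0 (by linarith)
  rw [ht3] at this; linarith

/-- Packings are defined through carriers, so this is what makes curvature a function of the point
set. The point `∞` separates round disks from the others, and an exterior contains points
arbitrarily far in the direction of any normal. -/
theorem Disk.carrier_injective : Function.Injective Disk.carrier := by
  intro D E h
  have hc : ∀ x : Plane, (x : ExtPlane) ∈ D.carrier ↔ (x : ExtPlane) ∈ E.carrier := by simp [h]
  have hi : OnePoint.infty ∈ D.carrier ↔ OnePoint.infty ∈ E.carrier := by rw [h]
  have aux : ∀ {c d : Plane} {r s : ℝ}, dist c d + r ≤ s → dist d c + s ≤ r → c = d ∧ r = s := by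
    intro c d r s h1 h2
    have := dist_nonneg (x := c) (y := d)
    rw [dist_comm d c] at h2
    exact ⟨dist_le_zero.1 (by linarith), by linarith⟩
  have aux2 : ∀ {c n : Plane} {r a : ℝ}, ‖n‖ = 1 →
      ¬ ∀ x : Plane, r ≤ dist x c ↔ inner ℝ n x ≤ a := by
    intro c n r a hn hx
    have hnn : inner ℝ n n = (1 : ℝ) := by rw [real_inner_self_eq_norm_sq, hn]; norm_num
    have h0 := abs_nonneg (a - inner ℝ n c)
    have h1 : 0 ≤ |a - inner ℝ n c| + |r| + 1 := by positivity
    have := (hx (c + (|a - inner ℝ n c| + |r| + 1) • n)).1 (by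
      rw [dist_eq_norm, add_sub_cancel_left, norm_smul, hn, Real.norm_of_nonneg h1]
      linarith [le_abs_self r])
    rw [inner_add_right, inner_smul_right, hnn] at this
    linarith [le_abs_self (a - inner ℝ n c), abs_nonneg r]
  cases D with
  | ball c r hr =>
    cases E with
    | ball d s hs =>
      simp only [coe_mem_ball] at hc
      obtain ⟨rfl, rfl⟩ := aux
        (dist_add_le_of_ball_subset hr fun x hx => (hc x).1 hx.le)
        (dist_add_le_of_ball_subset hs fun x hx => (hc x).2 hx.le)
      rfl
    | exterior d s hs => simp [Disk.infty_mem_carrier, Disk.curvature, hr.not_ge, hs.le] at hi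
    | halfPlane n hn a => simp [Disk.infty_mem_carrier, Disk.curvature, hr.not_ge] at hi
  | exterior c r hr =>
    cases E with
    | ball d s hs => simp [Disk.infty_mem_carrier, Disk.curvature, hr.le, hs.not_ge] at hi
    | exterior d s hs =>
      simp only [coe_mem_exterior, ← not_lt, not_iff_not] at hc
      obtain ⟨rfl, rfl⟩ := aux
        (dist_add_le_of_ball_subset hr fun x hx => ((hc x).1 hx).le)
        (dist_add_le_of_ball_subset hs fun x hx => ((hc x).2 hx).le)
      rfl
    | halfPlane n hn a =>
      simp only [coe_mem_exterior, coe_mem_halfPlane] at hc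
      exact absurd hc (aux2 hn)
  | halfPlane n hn a =>
    cases E with
    | ball d s hs => simp [Disk.infty_mem_carrier, Disk.curvature, hs.not_ge] at hi
    | exterior d s hs =>
      simp only [coe_mem_exterior, coe_mem_halfPlane] at hc
      exact absurd (fun x => (hc x).symm) (aux2 hn)
    | halfPlane m hm b =>
      simp only [coe_mem_halfPlane] at hc
      obtain ⟨rfl, hab⟩ := halfPlane_subset hn hm fun x => (hc x).1
      obtain rfl := hab.antisymm (halfPlane_subset hm hn fun x => (hc x).2).2
      rfl

theorem Disk.vec_eq_of_carrier_eq {D : Disk} {x : Lor} (hx : lorentz x x = 1)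
    (h : D.carrier = region x) : D.vec = x := by
  obtain ⟨E, rfl⟩ := Disk.exists_vec_eq hx
  rw [Disk.carrier_injective (h.trans E.carrier_eq_region.symm)]

theorem Disk.vec_injective : Function.Injective Disk.vec := fun D E h =>
  Disk.carrier_injective (by rw [D.carrier_eq_region, E.carrier_eq_region, h])

/-- Excludes a disk tangent to itself, so that tangent disks come from different vertices. -/
theorem Disk.carrier_ne_singleton (D : Disk) (p : ExtPlane) : D.carrier ≠ {p} := by
  intro h
  obtain ⟨x, y, hxy, hx, hy⟩ : ∃ x y : Plane, x ≠ y ∧ (x : ExtPlane) ∈ D.carrier ∧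
      (y : ExtPlane) ∈ D.carrier := by
    have e0 : ‖(EuclideanSpace.single 0 1 : Plane)‖ = 1 := by simp
    cases D with
    | ball c r hr =>
      refine ⟨c, c + r • EuclideanSpace.single 0 1, ?_, ?_, ?_⟩
      · intro h
        have := congrArg (fun z : Plane => z 0) h
        simp at this; exact hr.ne' this
      · simp [coe_mem_ball, hr.le]
      · simp [coe_mem_ball, abs_of_pos hr, norm_smul]
    | exterior c r hr =>
      refine ⟨c - r • EuclideanSpace.single 0 1, c + r • EuclideanSpace.single 0 1, ?_, ?_, ?_⟩
      · intro h
        have := congrArg (fun z : Plane => z 0) h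
        simp at this; linarith
      · simp [coe_mem_exterior, abs_of_pos hr, norm_smul]
      · simp [coe_mem_exterior, abs_of_pos hr, norm_smul]
    | halfPlane n hn a =>
      have hnn : inner ℝ n n = (1 : ℝ) := by rw [real_inner_self_eq_norm_sq, hn]; norm_num
      refine ⟨a • n, (a - 1) • n, ?_, ?_, ?_⟩
      · intro h
        have := congrArg (fun z : Plane => inner ℝ n z) h
        simp only [inner_smul_right, hnn] at this; linarith
      · simp only [coe_mem_halfPlane, inner_smul_right, hnn]; linarith
      · simp only [coe_mem_halfPlane, inner_smul_right, hnn]; linarith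
  rw [h] at hx hy
  exact hxy (OnePoint.coe_injective (hx.trans hy.symm))

/-! ### Inversions act as Lorentz reflections -/

theorem circleInversionFun_infty (c : Plane) (r : ℝ) :
    circleInversionFun c r OnePoint.infty = c := rfl

theorem circleInversionFun_center (c : Plane) (r : ℝ) :
    circleInversionFun c r c = OnePoint.infty := if_pos rfl

theorem circleInversionFun_coe {c x : Plane} (r : ℝ) (h : x ≠ c) :
    circleInversionFun c r x = (EuclideanGeometry.inversion c r x : Plane) := if_neg h

theorem circleEval_infty (x : Lor) : circleEval x OnePoint.infty = x 0 := rfl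

theorem circleEval_coe (x : Lor) (p : Plane) :
    circleEval x p = x 0 * (p 0 ^ 2 + p 1 ^ 2) - 2 * (x 1 * p 0 + x 2 * p 1) + x 3 := rfl

/-- The factor `k` depends on the point (it is `r² / |y - c|²` at a general one), but its positivity
is enough to carry regions to regions. -/
theorem circleEval_circleInversionFun (c : Plane) {r : ℝ} (hr : 0 < r) (x : Lor) (p : ExtPlane) :
    ∃ k : ℝ, 0 < k ∧ circleEval x (circleInversionFun c r p) =
      k * circleEval (lorentzReflection
        ![1 / r, c 0 / r, c 1 / r, (c 0 ^ 2 + c 1 ^ 2 - r ^ 2) / r] x) p := by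
  have hr2 : 0 < r ^ 2 := by positivity
  induction p using OnePoint.rec with
  | infty =>
    refine ⟨r ^ 2, hr2, ?_⟩
    rw [circleInversionFun_infty, circleEval_infty, circleEval_coe]
    simp [lorentzReflection, lorentz]
    field_simp
    ring
  | coe y =>
    by_cases hy : y = c
    · subst hy
      refine ⟨1 / r ^ 2, by positivity, ?_⟩
      rw [circleInversionFun_center, circleEval_infty, circleEval_coe]
      simp [lorentzReflection, lorentz]
      field_simp
      ring
    · have hd : 0 < (y 0 - c 0) ^ 2 + (y 1 - c 1) ^ 2 := by
        rw [← dist_sq_plane]; exact pow_pos (dist_pos.2 hy) 2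
      refine ⟨r ^ 2 / ((y 0 - c 0) ^ 2 + (y 1 - c 1) ^ 2), by positivity, ?_⟩
      rw [circleInversionFun_coe _ hy, circleEval_coe, circleEval_coe,
        EuclideanGeometry.inversion, div_pow, dist_sq_plane]
      simp [lorentzReflection, lorentz]
      field_simp
      ring

theorem circleEval_lineReflectionFun {n : Plane} (hn : ‖n‖ = 1) (a : ℝ) (x : Lor) (p : ExtPlane) :
    circleEval x (lineReflectionFun n a p) =
      circleEval (lorentzReflection ![0, -n 0, -n 1, -2 * a] x) p := by
  induction p using OnePoint.rec with
  | infty =>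
    change circleEval x OnePoint.infty = _
    rw [circleEval_infty, circleEval_infty]
    simp [lorentzReflection]
  | coe y =>
    change circleEval x ((y - (2 * (inner ℝ n y - a)) • n : Plane) : ExtPlane) = _
    have h := norm_sq_plane n
    rw [hn] at h
    rw [circleEval_coe, circleEval_coe, inner_plane]
    simp [lorentzReflection, lorentz]
    linear_combination (-4 * x 0 * (n 0 * y 0 + n 1 * y 1 - a) ^ 2) * h

theorem lorentzReflection_neg (f x : Lor) : lorentzReflection (-f) x = lorentzReflection f x := by
  ext i
  simp [lorentzReflection, lorentz]; ring

theorem Disk.circleEval_inversion (D : Disk) (x : Lor) (p : ExtPlane) :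
    ∃ k : ℝ, 0 < k ∧
      circleEval x (D.inversion p) = k * circleEval (lorentzReflection D.vec x) p := by
  cases D with
  | ball c r hr => exact circleEval_circleInversionFun c hr x p
  | exterior c r hr =>
    rw [Disk.vec, lorentzReflection_neg]
    exact circleEval_circleInversionFun c hr x p
  | halfPlane n hn a =>
    exact ⟨1, one_pos, by rw [one_mul]; exact circleEval_lineReflectionFun hn a x p⟩

theorem Disk.inversion_involutive (D : Disk) : Function.Involutive D.inversion := by
  cases D with
  | ball c r hr => exact circleInversionFun_involutive c hr
  | exterior c r hr => exact circleInversionFun_involutive c hr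
  | halfPlane n hn a => exact lineReflectionFun_involutive hn a

theorem Disk.inversion_image_region (D : Disk) (x : Lor) :
    D.inversion '' region x = region (lorentzReflection D.vec x) := by
  ext p
  rw [D.inversion_involutive.image_eq_preimage_symm]
  obtain ⟨k, hk, h⟩ := D.circleEval_inversion x p
  rw [Set.mem_preimage, region, region, Set.mem_ofPred_eq, Set.mem_ofPred_eq, h,
    mul_nonpos_iff_of_pos hk]

theorem lorentz_lorentzReflection {f : Lor} (hf : lorentz f f = 1) (x y : Lor) :
    lorentz (lorentzReflection f x) (lorentzReflection f y) = lorentz x y := by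
  simp only [lorentzReflection, lorentz_sub_left, lorentz_sub_right, lorentz_smul_left,
    lorentz_smul_right, hf, lorentz_comm f y]
  ring

theorem lorentzReflection_involutive {f : Lor} (hf : lorentz f f = 1) :
    Function.Involutive (lorentzReflection f) := by
  intro x
  simp only [lorentzReflection, lorentz_sub_left, lorentz_smul_left, hf]
  module

/-! ### Möbius transformations as Lorentz isometries -/

/-- A linear Lorentz isometry `M` induces the transformation `g` of the extended plane. -/
structure Induces (M : Lor ≃ₗ[ℝ] Lor) (g : Equiv.Perm ExtPlane) : Prop where
  lorentz_map : ∀ x y, lorentz (M x) (M y) = lorentz x y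
  image_region : ∀ x, g '' region x = region (M x)

/-- The Lorentz reflection as a linear equivalence. -/
def reflectionEquiv (f : Lor) (hf : lorentz f f = 1) : Lor ≃ₗ[ℝ] Lor :=
  LinearEquiv.ofInvolutive
    { toFun := lorentzReflection f
      map_add' := fun x y => by
        simp only [lorentzReflection, lorentz_add_left]; module
      map_smul' := fun a x => by
        simp only [lorentzReflection, lorentz_smul_left, RingHom.id_apply]; module }
    (lorentzReflection_involutive hf)

theorem reflectionEquiv_apply (f : Lor) (hf : lorentz f f = 1) (x : Lor) :
    reflectionEquiv f hf x = lorentzReflection f x := rfl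

theorem Disk.induces_inversion (D : Disk) :
    Induces (reflectionEquiv D.vec D.lorentz_vec_self) D.inversion :=
  ⟨lorentz_lorentzReflection D.lorentz_vec_self, D.inversion_image_region⟩

theorem Induces.mul {M N : Lor ≃ₗ[ℝ] Lor} {g h : Equiv.Perm ExtPlane} (hM : Induces M g)
    (hN : Induces N h) : Induces (N.trans M) (g * h) where
  lorentz_map x y := by simp [hM.lorentz_map, hN.lorentz_map]
  image_region x := by
    rw [Equiv.Perm.coe_mul, Set.image_comp, hN.image_region, hM.image_region]; rfl

theorem Induces.refl : Induces (LinearEquiv.refl ℝ Lor) 1 where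
  lorentz_map x y := rfl
  image_region x := by simp

theorem Induces.inv {M : Lor ≃ₗ[ℝ] Lor} {g : Equiv.Perm ExtPlane} (hM : Induces M g) :
    Induces M.symm g⁻¹ where
  lorentz_map x y := by rw [← hM.lorentz_map]; simp
  image_region x := by
    have := hM.image_region (M.symm x)
    rw [M.apply_symm_apply] at this
    rw [← this, ← Set.image_comp, ← Equiv.Perm.coe_mul, inv_mul_cancel]
    simp

theorem exists_induces {g : Equiv.Perm ExtPlane} (hg : g ∈ moebiusGroup) :
    ∃ M, Induces M g := by
  induction hg using Subgroup.closure_induction with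
  | mem g hg =>
    obtain ⟨D, rfl⟩ := hg
    exact ⟨_, D.induces_inversion⟩
  | one => exact ⟨_, Induces.refl⟩
  | mul g h _ _ hg hh =>
    obtain ⟨M, hM⟩ := hg
    obtain ⟨N, hN⟩ := hh
    exact ⟨_, hM.mul hN⟩
  | inv g _ hg =>
    obtain ⟨M, hM⟩ := hg
    exact ⟨_, hM.inv⟩

/-- A group generated by inversions in disks whose reflections preserve a lattice acts on the
lattice. -/
theorem exists_induces_preserving {S : Set Disk} {Λ : AddSubgroup Lor}
    (hS : ∀ D ∈ S, ∀ x ∈ Λ, lorentzReflection D.vec x ∈ Λ) {g : Equiv.Perm ExtPlane}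
    (hg : g ∈ Subgroup.closure (Disk.inversion '' S)) :
    ∃ M, Induces M g ∧ ∀ x, M x ∈ Λ ↔ x ∈ Λ := by
  induction hg using Subgroup.closure_induction with
  | mem g hg =>
    obtain ⟨D, hD, rfl⟩ := hg
    refine ⟨_, D.induces_inversion, fun x => ⟨fun h => ?_, hS D hD x⟩⟩
    have := hS D hD _ h
    rwa [reflectionEquiv_apply, lorentzReflection_involutive D.lorentz_vec_self] at this
  | one => exact ⟨_, Induces.refl, fun x => Iff.rfl⟩
  | mul g h _ _ hg hh =>
    obtain ⟨M, hM, hM'⟩ := hg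
    obtain ⟨N, hN, hN'⟩ := hh
    exact ⟨_, hM.mul hN, fun x => by simp [hM', hN']⟩
  -- An equivalence, rather than one implication, is what passes to inverses.
  | inv g _ hg =>
    obtain ⟨M, hM, hM'⟩ := hg
    exact ⟨_, hM.inv, fun x => by rw [← hM', M.apply_symm_apply]⟩

theorem norm_sq_space (v : Space) : ‖v‖ ^ 2 = v 0 ^ 2 + v 1 ^ 2 + v 2 ^ 2 := by
  rw [EuclideanSpace.real_norm_sq_eq, Fin.sum_univ_three]

theorem inner_space (v w : Space) : inner ℝ v w = v 0 * w 0 + v 1 * w 1 + v 2 * w 2 := by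
  simp [PiLp.inner_apply, Fin.sum_univ_three, mul_comm]

/-! ### Spherical caps -/

/-- The Lorentz vector with space part `v` and time part `t`. -/
def lift (v : Space) (t : ℝ) : Lor := ![t - v 2, v 0, v 1, t + v 2]

theorem lorentz_lift (v w : Space) (s t : ℝ) :
    lorentz (lift v s) (lift w t) = inner ℝ v w - s * t := by
  simp [lorentz, lift, inner_space]; ring

theorem exists_eq_lift (x : Lor) : ∃ v t, x = lift v t := by
  refine ⟨!₂[x 1, x 2, (x 3 - x 0) / 2], (x 0 + x 3) / 2, ?_⟩
  ext i
  fin_cases i <;> simp [lift] <;> ring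

theorem smul_lift (a : ℝ) (v : Space) (t : ℝ) : a • lift v t = lift (a • v) (a * t) := by
  ext i
  fin_cases i <;> simp [lift] <;> ring

theorem circleEval_add (x y : Lor) (p : ExtPlane) :
    circleEval (x + y) p = circleEval x p + circleEval y p := by
  induction p using OnePoint.rec with
  | infty => rfl
  | coe p => simp only [circleEval_coe, Pi.add_apply]; ring

theorem circleEval_smul (a : ℝ) (x : Lor) (p : ExtPlane) :
    circleEval (a • x) p = a * circleEval x p := by
  induction p using OnePoint.rec with
  | infty => rfl
  | coe p => simp only [circleEval_coe, Pi.smul_apply, smul_eq_mul]; ring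

theorem region_smul {a : ℝ} (ha : 0 < a) (x : Lor) : region (a • x) = region x := by
  ext p
  rw [region, region, Set.mem_ofPred_eq, Set.mem_ofPred_eq, circleEval_smul,
    mul_nonpos_iff_of_pos ha]

/-- Complete the square: `x 0` times the value at `p` is `|x 0 p - (x 1, x 2)|²` plus the positive
number `x 0 x 3 - x 1² - x 2²`. -/
theorem circleEval_pos_of_timelike {x : Lor} (hx : lorentz x x < 0) (ht : 0 < x 0 + x 3)
    (p : ExtPlane) : 0 < circleEval x p := by
  have h : x 1 ^ 2 + x 2 ^ 2 < x 0 * x 3 := by rw [lorentz] at hx; nlinarith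
  have h0 : 0 < x 0 := by
    by_contra h0
    nlinarith [sq_nonneg (x 1), sq_nonneg (x 2)]
  induction p using OnePoint.rec with
  | infty => exact h0
  | coe p =>
    rw [circleEval_coe]
    refine pos_of_mul_pos_right (a := x 0) ?_ h0.le
    nlinarith [sq_nonneg (x 0 * p 0 - x 1), sq_nonneg (x 0 * p 1 - x 2)]

theorem exists_stereo_eq (p : ExtPlane) : ∃ u : Space, ‖u‖ = 1 ∧ stereo u = p := by
  induction p using OnePoint.rec with
  | infty => exact ⟨EuclideanSpace.single 2 1, by simp, by simp [stereo]⟩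
  | coe x =>
    have h : 0 < x 0 ^ 2 + x 1 ^ 2 + 1 := by positivity
    refine ⟨!₂[2 * x 0 / (x 0 ^ 2 + x 1 ^ 2 + 1), 2 * x 1 / (x 0 ^ 2 + x 1 ^ 2 + 1),
      (x 0 ^ 2 + x 1 ^ 2 - 1) / (x 0 ^ 2 + x 1 ^ 2 + 1)], ?_, ?_⟩
    · rw [← sq_eq_sq₀ (norm_nonneg _) zero_le_one, norm_sq_space]
      simp; field_simp; ring
    · rw [stereo, if_neg]
      · congr 1
        ext i
        have h1 : 1 - (x 0 ^ 2 + x 1 ^ 2 - 1) / (x 0 ^ 2 + x 1 ^ 2 + 1)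
          = 2 / (x 0 ^ 2 + x 1 ^ 2 + 1) := by field_simp; ring
        fin_cases i <;> simp <;> rw [h1] <;> field_simp
      · simp only [Matrix.cons_val]
        rw [div_eq_one_iff_eq h.ne']
        linarith

/-- Pulled back to the sphere, a circle equation becomes the equation of the plane `⟨u, v⟩ = 1`. At
finite points the factor is `2 / (1 - u 2) = |p|² + 1`. -/
theorem circleEval_stereo {u : Space} (hu : ‖u‖ = 1) (v : Space) :
    ∃ k : ℝ, 0 < k ∧ circleEval (lift v 1) (stereo u) = k * (1 - inner ℝ u v) := by
  have h : u 0 ^ 2 + u 1 ^ 2 + u 2 ^ 2 = 1 := by rw [← norm_sq_space, hu]; norm_num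
  rw [inner_space]
  by_cases h2 : u 2 = 1
  · have h0 : u 0 = 0 := by nlinarith [sq_nonneg (u 0), sq_nonneg (u 1)]
    have h1 : u 1 = 0 := by nlinarith [sq_nonneg (u 0), sq_nonneg (u 1)]
    refine ⟨1, one_pos, ?_⟩
    rw [stereo, if_pos h2, circleEval_infty, h0, h1, h2]
    simp [lift]
  · have hlt : 0 < 1 - u 2 := by
      have : u 2 ≤ 1 := by nlinarith [sq_nonneg (u 0), sq_nonneg (u 1)]
      rcases this.lt_or_eq with h | h
      · linarith
      · exact absurd h h2
    refine ⟨2 / (1 - u 2), by positivity, ?_⟩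
    rw [stereo, if_neg h2, circleEval_coe]
    simp [lift]
    field_simp
    linear_combination (1 - v 2) * h

theorem stereo_image_illuminated (v : Space) : stereo '' illuminated v = region (lift v 1) := by
  ext p
  constructor
  · rintro ⟨u, ⟨hu, huv⟩, rfl⟩
    obtain ⟨k, hk, h⟩ := circleEval_stereo hu v
    rw [region, Set.mem_ofPred_eq, h, mul_nonpos_iff_of_pos hk]
    linarith
  · intro hp
    obtain ⟨u, hu, rfl⟩ := exists_stereo_eq p
    obtain ⟨k, hk, h⟩ := circleEval_stereo hu v
    rw [region, Set.mem_ofPred_eq, h, mul_nonpos_iff_of_pos hk] at hp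
    exact ⟨u, ⟨hu, by linarith⟩, rfl⟩

/-- The Lorentz vector of norm one of the cap illuminated from `v`. -/
def capVec (v : Space) : Lor := (√(‖v‖ ^ 2 - 1))⁻¹ • lift v 1

theorem sqrt_inv_pos {v : Space} (hv : 1 < ‖v‖) : 0 < (√(‖v‖ ^ 2 - 1))⁻¹ :=
  inv_pos.2 (Real.sqrt_pos.2 (by nlinarith))

theorem sqrt_inv_sq_mul {v : Space} (hv : 1 < ‖v‖) :
    (√(‖v‖ ^ 2 - 1))⁻¹ ^ 2 * (‖v‖ ^ 2 - 1) = 1 := by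
  have : 0 < ‖v‖ ^ 2 - 1 := by nlinarith
  rw [inv_pow, Real.sq_sqrt this.le, inv_mul_cancel₀ this.ne']

theorem lorentz_capVec_self {v : Space} (hv : 1 < ‖v‖) : lorentz (capVec v) (capVec v) = 1 := by
  rw [capVec, lorentz_smul_left, lorentz_smul_right, lorentz_lift, real_inner_self_eq_norm_sq]
  linear_combination sqrt_inv_sq_mul hv

theorem region_capVec {v : Space} (hv : 1 < ‖v‖) : region (capVec v) = stereo '' illuminated v := by
  rw [capVec, region_smul (sqrt_inv_pos hv), stereo_image_illuminated]

theorem capVec_time_pos {v : Space} (hv : 1 < ‖v‖) : 0 < capVec v 0 + capVec v 3 := by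
  have := sqrt_inv_pos hv
  simp [capVec, lift]
  linarith

theorem eq_of_capVec_eq {v w : Space} (hw : 1 < ‖w‖) (h : capVec v = capVec w) :
    v = w := by
  have hsum : (√(‖v‖ ^ 2 - 1))⁻¹ = (√(‖w‖ ^ 2 - 1))⁻¹ := by
    have h0 := congrFun h 0
    have h3 := congrFun h 3
    simp only [capVec, lift, Pi.smul_apply, Matrix.cons_val, smul_eq_mul] at h0 h3
    linarith
  rw [capVec, capVec, hsum] at h
  have h' := smul_right_injective Lor (sqrt_inv_pos hw).ne' h
  ext i
  have h0 := congrFun h' 0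
  have h1 := congrFun h' 1
  have h2 := congrFun h' 2
  simp only [lift, Matrix.cons_val] at h0 h1 h2
  fin_cases i
  · exact h1
  · exact h2
  · simpa using h0

/-- The sum of the two vectors has norm `2 + 2 ⟨·,·⟩ < 0` and positive time part, so it is positive
everywhere; on a common point it would be nonpositive. -/
theorem disjoint_region_capVec {v w : Space} (hv : 1 < ‖v‖) (hw : 1 < ‖w‖)
    (h : lorentz (capVec v) (capVec w) < -1) (p : ExtPlane) (hp : p ∈ region (capVec v))
    (hp' : p ∈ region (capVec w)) : False := by
  have h1 : circleEval (capVec v) p ≤ 0 := hp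
  have h2 : circleEval (capVec w) p ≤ 0 := hp'
  have := circleEval_pos_of_timelike (x := capVec v + capVec w) (by
    simp only [lorentz_add_left, lorentz_add_right, lorentz_capVec_self hv, lorentz_capVec_self hw,
      lorentz_comm (capVec w) (capVec v)]
    linarith) (by
    have := capVec_time_pos hv
    have := capVec_time_pos hw
    simp only [Pi.add_apply]; linarith) p
  rw [circleEval_add] at this
  linarith

/-- Caps illuminated from the ends of a segment tangent to the sphere are tangent. -/
theorem lorentz_capVec_of_tangent {v w : Space} (hv : 1 < ‖v‖) (hw : 1 < ‖w‖)
    (h : (∃ p ∈ segment ℝ v w, ‖p‖ = 1) ∧ ∀ q ∈ affineSpan ℝ {v, w}, 1 ≤ ‖q‖) :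
    lorentz (capVec v) (capVec w) = -1 := by
  obtain ⟨⟨p, ⟨a, b, ha, hb, hab, rfl⟩, hp⟩, hq⟩ := h
  set p := a • v + b • w with hpdef
  have hpp : inner ℝ p p = (1 : ℝ) := by rw [real_inner_self_eq_norm_sq, hp]; norm_num
  have hline : ∀ t : ℝ, 0 ≤ 2 * t * inner ℝ p (w - v) + t ^ 2 * inner ℝ (w - v) (w - v) := by
    intro t
    have hmem : p + t • (w - v) ∈ affineSpan ℝ {v, w} := by
      have : p + t • (w - v) = AffineMap.lineMap v w (b + t) := by
        rw [AffineMap.lineMap_apply_module', hpdef, show a = 1 - b by linarith]; module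
      rw [this]
      exact AffineMap.lineMap_mem_affineSpan_pair _ _ _
    have h1 : 1 ≤ inner ℝ (p + t • (w - v)) (p + t • (w - v)) := by
      rw [real_inner_self_eq_norm_sq]; nlinarith [hq _ hmem]
    rw [real_inner_add_add_self, hpp, inner_smul_left, inner_smul_right, inner_smul_right] at h1
    simp only [conj_trivial] at h1
    nlinarith
  have hperp : inner ℝ p (w - v) = (0 : ℝ) := by
    set c : ℝ := inner ℝ p (w - v)
    set d : ℝ := inner ℝ (w - v) (w - v)
    have hd : 0 ≤ d := real_inner_self_nonneg
    -- The minimizing step, with `d + 1` in place of `d` to avoid a zero denominator.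
    have := hline (-c / (d + 1))
    have e : 2 * (-c / (d + 1)) * c + (-c / (d + 1)) ^ 2 * d = -(c ^ 2 * (d + 2)) / (d + 1) ^ 2 := by
      field_simp; ring
    rw [e, le_div_iff₀ (by positivity)] at this
    nlinarith [sq_nonneg c]
  have hvv : inner ℝ v v = ‖v‖ ^ 2 := real_inner_self_eq_norm_sq v
  have hww : inner ℝ w w = ‖w‖ ^ 2 := real_inner_self_eq_norm_sq w
  have hwv : inner ℝ w v = inner ℝ v w := real_inner_comm _ _
  simp only [hpdef, inner_add_left, inner_add_right, inner_sub_right, inner_smul_left,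
    inner_smul_right, conj_trivial, hvv, hww, hwv] at hpp hperp
  set x : ℝ := inner ℝ v w
  have hb' : b = 1 - a := by linarith
  subst hb'
  have ev : a * ‖v‖ ^ 2 + (1 - a) * x = 1 := by linear_combination hpp - (1 - a) * hperp
  have ew : a * x + (1 - a) * ‖w‖ ^ 2 = 1 := by linear_combination hpp + a * hperp
  have hv2 : 0 < ‖v‖ ^ 2 - 1 := by nlinarith
  have hw2 : 0 < ‖w‖ ^ 2 - 1 := by nlinarith
  have hx : 0 ≤ 1 - x := by
    by_contra hx
    rcases ha.lt_or_eq with h | h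
    · nlinarith
    · rw [← h] at ew; nlinarith
  -- Eliminating `a` from `⟨p, v⟩ = ⟨p, w⟩ = 1`. The case `a = 0` would put `w` on the sphere.
  have hx2 : (1 - x) ^ 2 = (‖v‖ ^ 2 - 1) * (‖w‖ ^ 2 - 1) := by
    by_cases h0 : a = 0
    · subst h0; nlinarith
    · have : a * ((1 - x) ^ 2 - (‖v‖ ^ 2 - 1) * (‖w‖ ^ 2 - 1)) = 0 := by
        linear_combination (-(‖w‖ ^ 2 - 1)) * ev + (x - 1) * ew
      rcases mul_eq_zero.1 this with h | h
      · exact absurd h h0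
      · linarith
  rw [capVec, capVec, lorentz_smul_left, lorentz_smul_right, lorentz_lift]
  change _ * (_ * (x - 1 * 1)) = _
  have hs : √(‖v‖ ^ 2 - 1) * √(‖w‖ ^ 2 - 1) = 1 - x := by
    rw [← Real.sqrt_mul hv2.le, ← hx2, Real.sqrt_sq hx]
  have hne : 1 - x ≠ 0 := by
    intro h; rw [h] at hx2; nlinarith [mul_pos hv2 hw2]
  rw [← mul_assoc, ← mul_inv, hs]
  field_simp
  ring

/-! ### Faces of polytopes -/

/-- A point of the hull mixes a point over `A` with a point over `S \ A`. On the latter `l < c`, so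
attaining `c` forces its weight to vanish. -/
theorem isExposed_convexHull {S A : Set Space} (hAS : A ⊆ S) (l : Space →L[ℝ] ℝ) (c : ℝ)
    (hA : ∀ x ∈ A, l x = c) (hS : ∀ x ∈ S, x ∉ A → l x < c) :
    IsExposed ℝ (convexHull ℝ S) (convexHull ℝ A) := by
  intro hne
  rw [convexHull_nonempty_iff] at hne
  have hlA : ∀ x ∈ convexHull ℝ A, l x = c :=
    convexHull_min (t := {x | l x = c}) hA (convex_hyperplane l.isLinear c)
  have hlS : ∀ x ∈ convexHull ℝ S, l x ≤ c := by
    refine convexHull_min (t := {x | l x ≤ c}) (fun x hx => ?_) (convex_halfSpace_le l.isLinear c)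
    by_cases hxA : x ∈ A
    · exact (hA x hxA).le
    · exact (hS x hx hxA).le
  refine ⟨l, Set.Subset.antisymm
    (fun x hx => ⟨convexHull_mono hAS hx, fun y hy => (hlS y hy).trans (hlA x hx).ge⟩) ?_⟩
  rintro x ⟨hxS, hmax⟩
  obtain ⟨a, ha⟩ := hne
  have hxc : l x = c :=
    (hlS x hxS).antisymm ((hA a ha).symm.le.trans (hmax a (subset_convexHull ℝ S (hAS ha))))
  by_cases hd : (S \ A).Nonempty
  · rw [← Set.union_sdiff_cancel hAS, convexHull_union ⟨a, ha⟩ hd, mem_convexJoin] at hxS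
    obtain ⟨y, hy, z, hz, s, t, hs, ht, hst, rfl⟩ := hxS
    have hz' : l z < c := convexHull_min (t := {x | l x < c}) (fun x hx => hS x hx.1 hx.2)
      (convex_halfSpace_lt l.isLinear c) hz
    rw [map_add, map_smul, map_smul, hlA y hy, smul_eq_mul, smul_eq_mul] at hxc
    have ht0 : t = 0 := by
      rcases ht.lt_or_eq with h | h
      · obtain rfl : s = 1 - t := by linarith
        nlinarith [mul_pos h (sub_pos.2 hz')]
      · exact h.symm
    obtain rfl : s = 1 := by linarith
    simpa [ht0] using hy
  · rw [Set.not_nonempty_iff_eq_empty, Set.sdiff_eq_empty] at hd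
    exact convexHull_mono hd hxS

/-- A combinatorial equivalence with a polytope whose labelled vertices are all exposed transports
the labels, and the faces recognized by linear functionals. -/
theorem CombEquiv.exists_labelling {ι : Type*} {P : Set Space} {q : ι → Space}
    (hP : CombEquiv P (convexHull ℝ (Set.range q)))
    (hq : ∀ i, ∃ l : Space →L[ℝ] ℝ, ∀ j, j ≠ i → l (q j) < l (q i)) :
    ∃ p : ι → Space, Function.Injective p ∧ Set.range p = vertices P ∧
      ∀ (A : Set ι) (l : Space →L[ℝ] ℝ) (c : ℝ), (∀ i ∈ A, l (q i) = c) →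
        (∀ i, i ∉ A → l (q i) < c) → IsExposed ℝ P (convexHull ℝ (p '' A)) := by
  have hqi : Function.Injective q := by
    intro i j hij
    by_contra hne
    obtain ⟨l, hl⟩ := hq i
    exact (hl j (Ne.symm hne)).ne (by rw [hij])
  have hv : ∀ i, q i ∈ vertices (convexHull ℝ (Set.range q)) := by
    intro i
    obtain ⟨l, hl⟩ := hq i
    have := isExposed_convexHull (S := Set.range q) (A := {q i}) (by simp) l (l (q i)) (by simp)
      (by rintro _ ⟨j, rfl⟩ hj; exact hl j fun h => hj (by rw [h]; rfl))
    rw [convexHull_singleton] at this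
    exact isExtreme_singleton.1 this.isExtreme
  have hv' : vertices (convexHull ℝ (Set.range q)) ⊆ Set.range q := extremePoints_convexHull_subset
  obtain ⟨φ, hφ⟩ := hP
  refine ⟨fun i => φ.symm ⟨q i, hv i⟩, fun i j hij => ?_, ?_, fun A l c h1 h2 => ?_⟩
  · have := φ.symm.injective (Subtype.ext hij)
    exact hqi (congrArg Subtype.val this)
  · ext x
    constructor
    · rintro ⟨i, rfl⟩
      exact Subtype.coe_prop _
    · intro hx
      obtain ⟨i, hi⟩ := hv' (φ ⟨x, hx⟩).2
      refine ⟨i, ?_⟩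
      have : (⟨q i, hv i⟩ : vertices (convexHull ℝ (Set.range q))) = φ ⟨x, hx⟩ := Subtype.ext hi
      simp only [this, φ.symm_apply_apply]
  · have := (hφ ((fun i => φ.symm ⟨q i, hv i⟩) '' A)).2 (by
      have e : (Subtype.val '' (φ '' ((fun i => φ.symm ⟨q i, hv i⟩) '' A))) = q '' A := by
        simp only [Set.image_image, φ.apply_symm_apply]
      rw [e]
      refine isExposed_convexHull (Set.image_subset_range q A) l c ?_ ?_
      · rintro _ ⟨i, hi, rfl⟩; exact h1 i hi
      · rintro _ ⟨i, rfl⟩ hi; exact h2 i fun h => hi ⟨i, h, rfl⟩)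
    rwa [Set.image_image] at this

theorem IsEdgeScribed.isCompact {P : Set Space} (hP : IsEdgeScribed P) : IsCompact P := by
  obtain ⟨S, hS, rfl⟩ := hP.polytope
  exact hS.isCompact_convexHull ℝ

theorem IsEdgeScribed.convex {P : Set Space} (hP : IsEdgeScribed P) : Convex ℝ P := by
  obtain ⟨S, hS, rfl⟩ := hP.polytope
  exact convex_convexHull ℝ S

theorem IsEdgeScribed.finite_vertices {P : Set Space} (hP : IsEdgeScribed P) :
    (vertices P).Finite := by
  obtain ⟨S, hS, rfl⟩ := hP.polytope
  exact hS.subset extremePoints_convexHull_subset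

theorem IsEdgeScribed.convexHull_vertices {P : Set Space} (hP : IsEdgeScribed P) :
    convexHull ℝ (vertices P) = P := by
  have := closure_convexHull_extremePoints hP.isCompact hP.convex
  rwa [(hP.finite_vertices.isCompact_convexHull ℝ).isClosed.closure_eq] at this

/-- A linear functional constant on the vertices is constant on `P`; evaluate it at the interior
point `0` and at a small multiple of `a`. -/
theorem IsEdgeScribed.eq_zero_of_inner_eq {P : Set Space} (hP : IsEdgeScribed P) {a : Space} {t : ℝ}
    (h : ∀ v ∈ vertices P, inner ℝ a v = t) : a = 0 ∧ t = 0 := by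
  have hall : ∀ x ∈ P, inner ℝ a x = t := by
    rw [← hP.convexHull_vertices]
    exact convexHull_min (t := {x | inner ℝ a x = t}) h
      (convex_hyperplane (innerSL ℝ a).isLinear t)
  have h0 : t = 0 := by rw [← hall 0 (interior_subset hP.zero_mem), inner_zero_right]
  refine ⟨?_, h0⟩
  obtain ⟨ε, hε, hball⟩ := Metric.mem_nhds_iff.1 (mem_interior_iff_mem_nhds.1 hP.zero_mem)
  have hpos : 0 < ε / 2 / (‖a‖ + 1) := by positivity
  have := hall ((ε / 2 / (‖a‖ + 1)) • a) (hball (by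
    rw [mem_ball_zero_iff, norm_smul, Real.norm_of_nonneg hpos.le, div_mul_eq_mul_div,
      div_lt_iff₀ (by positivity)]
    nlinarith [norm_nonneg a]))
  rw [inner_smul_right, h0] at this
  exact inner_self_eq_zero.1 ((mul_eq_zero.1 this).resolve_left hpos.ne')

theorem IsEdgeScribed.eq_zero_of_lorentz_capVec {P : Set Space} (hP : IsEdgeScribed P) {y : Lor}
    (h : ∀ v ∈ vertices P, lorentz y (capVec v) = 0) : y = 0 := by
  obtain ⟨a, t, rfl⟩ := exists_eq_lift y
  obtain ⟨rfl, rfl⟩ := hP.eq_zero_of_inner_eq (a := a) (t := t) (by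
    intro v hv
    have := h v hv
    rw [capVec, lorentz_smul_right, lorentz_lift] at this
    linarith [(mul_eq_zero.1 this).resolve_left (sqrt_inv_pos (hP.outside v hv)).ne'])
  ext i
  fin_cases i <;> simp [lift]

/-- A face with at least one vertex, but not all of them, is cut out by a Lorentz vector. -/
theorem IsEdgeScribed.exists_lorentz_face {P : Set Space} (hP : IsEdgeScribed P) {T : Set Space}
    (hne : T.Nonempty) (hface : IsExposed ℝ P (convexHull ℝ T)) :
    ∃ y : Lor, (∀ v ∈ T, lorentz y (capVec v) = 0) ∧
      ∀ v ∈ vertices P, v ∉ T → lorentz y (capVec v) < 0 := by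
  obtain ⟨l, hl⟩ := hface (convexHull_nonempty_iff.2 hne)
  obtain ⟨v₀, hv₀⟩ := hne
  have hmem : ∀ v ∈ T, v ∈ P ∧ ∀ y ∈ P, l y ≤ l v := by
    intro v hv
    have : v ∈ convexHull ℝ T := subset_convexHull ℝ T hv
    rw [hl] at this
    exact this
  set a := (InnerProductSpace.toDual ℝ Space).symm l with ha
  have hla : ∀ x, inner ℝ a x = l x := fun x => InnerProductSpace.toDual_symm_apply
  have hcap : ∀ v, lorentz (lift a (l v₀)) (capVec v) = (√(‖v‖ ^ 2 - 1))⁻¹ * (l v - l v₀) := by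
    intro v
    rw [capVec, lorentz_smul_right, lorentz_lift, hla, mul_one]
  refine ⟨lift a (l v₀), fun v hv => ?_, fun v hv hvT => ?_⟩
  · rw [hcap, ((hmem v₀ hv₀).2 v (hmem v hv).1).antisymm ((hmem v hv).2 v₀ (hmem v₀ hv₀).1),
      sub_self, mul_zero]
  · rw [hcap]
    refine mul_neg_of_pos_of_neg (sqrt_inv_pos (hP.outside v hv)) ?_
    rcases ((hmem v₀ hv₀).2 v hv.1).lt_or_eq with h | h
    · linarith
    · exfalso
      -- A vertex of `P` lying in the face is an extreme point of `convexHull ℝ T`, hence belongs to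
      -- `T`.
      refine hvT (extremePoints_convexHull_subset (𝕜 := ℝ) ?_)
      have hvF : v ∈ convexHull ℝ T := by
        rw [hl]
        exact ⟨hv.1, fun y hy => ((hmem v₀ hv₀).2 y hy).trans h.ge⟩
      refine inter_extremePoints_subset_extremePoints_of_subset ?_ ⟨hvF, hv⟩
      rw [hl]; exact fun x hx => hx.1

/-- If `y` were nonzero and orthogonal to all tight vertices, `f ± ε y` would both lie in the polar
for small `ε`, as there are finitely many vertices; this contradicts extremality. -/
theorem IsEdgeScribed.polar_vertex {P : Set Space} (hP : IsEdgeScribed P) {f : Space}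
    (hf : f ∈ vertices (polar P)) : (∀ v ∈ vertices P, inner ℝ v f ≤ 1) ∧
      ∀ y, (∀ v ∈ vertices P, inner ℝ v f = 1 → inner ℝ v y = 0) → y = 0 := by
  have hle : ∀ v ∈ vertices P, inner ℝ v f ≤ 1 := fun v hv => hf.1 v hv.1
  refine ⟨hle, fun y hy => ?_⟩
  have hmem : ∀ u : Space, (∀ v ∈ vertices P, inner ℝ v u ≤ 1) → u ∈ polar P := by
    intro u hu
    have : ∀ x ∈ P, inner ℝ u x ≤ 1 := by
      rw [← hP.convexHull_vertices]
      exact convexHull_min (t := {x | inner ℝ u x ≤ 1})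
        (fun v hv => by rw [Set.mem_ofPred_eq, real_inner_comm]; exact hu v hv)
        (convex_halfSpace_le (innerSL ℝ u).isLinear 1)
    intro x hx
    rw [real_inner_comm]
    exact this x hx
  have hev : ∀ᶠ ε : ℝ in nhds 0, ∀ v ∈ vertices P,
      inner ℝ v (f + ε • y) ≤ 1 ∧ inner ℝ v (f - ε • y) ≤ 1 := by
    rw [Filter.eventually_all_finite hP.finite_vertices]
    intro v hv
    rcases (hle v hv).lt_or_eq with h | h
    · have c1 : Continuous fun ε : ℝ => inner ℝ v (f + ε • y) := by fun_prop
      have c2 : Continuous fun ε : ℝ => inner ℝ v (f - ε • y) := by fun_prop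
      filter_upwards [c1.continuousAt.eventually_lt_const (by simpa using h),
        c2.continuousAt.eventually_lt_const (by simpa using h)] with ε h1 h2
      exact ⟨h1.le, h2.le⟩
    · refine Filter.Eventually.of_forall fun ε => ?_
      rw [inner_add_right, inner_sub_right, inner_smul_right, hy v hv h, h]
      simp
  obtain ⟨ε, hε, hεpos⟩ := ((hev.filter_mono nhdsWithin_le_nhds).and
    (self_mem_nhdsWithin (s := Set.Ioi (0 : ℝ)))).exists
  have hext := (mem_extremePoints.1 hf).2 (f + ε • y) (hmem _ fun v hv => (hε v hv).1)
    (f - ε • y) (hmem _ fun v hv => (hε v hv).2)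
    ⟨1 / 2, 1 / 2, by norm_num, by norm_num, by norm_num, by module⟩
  have : ε • y = 0 := by simpa using hext.1
  exact (smul_eq_zero.1 this).resolve_left (ne_of_gt hεpos)

/-- The Lorentz vector of a vertex of the polar is determined up to scaling by the vertices of the
polytope at which its inequality is sharp. -/
theorem IsEdgeScribed.polar_vertex_lorentz {P : Set Space} (hP : IsEdgeScribed P) {f : Space}
    (hf : f ∈ vertices (polar P)) : (∀ v ∈ vertices P, lorentz (lift f 1) (capVec v) ≤ 0) ∧
      ∀ z, (∀ v ∈ vertices P, lorentz (lift f 1) (capVec v) = 0 → lorentz z (capVec v) = 0) →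
        ∃ c : ℝ, z = c • lift f 1 := by
  obtain ⟨h1, h2⟩ := hP.polar_vertex hf
  have hcap : ∀ v (a : Space) (t : ℝ), lorentz (lift a t) (capVec v) =
      (√(‖v‖ ^ 2 - 1))⁻¹ * (inner ℝ v a - t) := by
    intro v a t
    rw [capVec, lorentz_smul_right, lorentz_lift, real_inner_comm, mul_one]
  refine ⟨fun v hv => ?_, fun z hz => ?_⟩
  · rw [hcap, mul_nonpos_iff_of_pos (sqrt_inv_pos (hP.outside v hv))]
    linarith [h1 v hv]
  · obtain ⟨a, t, rfl⟩ := exists_eq_lift z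
    refine ⟨t, ?_⟩
    rw [smul_lift, mul_one]
    congr 1
    refine sub_eq_zero.1 (h2 _ fun v hv hvf => ?_)
    have := hz v hv (by rw [hcap, hvf, sub_self, mul_zero])
    rw [hcap] at this
    have := (mul_eq_zero.1 this).resolve_left (sqrt_inv_pos (hP.outside v hv)).ne'
    rw [inner_sub_right, inner_smul_right, hvf]
    linarith

theorem IsEdgeScribed.lorentz_capVec_of_exposed {P : Set Space} (hP : IsEdgeScribed P) {v w : Space}
    (hv : v ∈ vertices P) (hw : w ∈ vertices P) (hvw : v ≠ w)
    (h : IsExposed ℝ P (convexHull ℝ {v, w})) : lorentz (capVec v) (capVec w) = -1 := by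
  rw [convexHull_pair] at h
  exact lorentz_capVec_of_tangent (hP.outside v hv) (hP.outside w hw)
    (hP.tangent v w ⟨hv, hw, hvw, h⟩)

/-! ### Lorentz frames -/

theorem exists_linear_relation (v₁ v₂ v₃ v₄ v₅ : Lor) : ∃ a b c d e : ℝ,
    a • v₁ + b • v₂ + c • v₃ + d • v₄ + e • v₅ = 0 ∧ ¬(a = 0 ∧ b = 0 ∧ c = 0 ∧ d = 0 ∧ e = 0) := by
  obtain ⟨g, hg, i, hi⟩ := Fintype.not_linearIndependent_iff.1
    (fun h : LinearIndependent ℝ ![v₁, v₂, v₃, v₄, v₅] => by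
      have := h.fintype_card_le_finrank
      simp at this)
  simp only [Fin.sum_univ_five, Matrix.cons_val] at hg
  refine ⟨g 0, g 1, g 2, g 3, g 4, hg, fun h => hi ?_⟩
  fin_cases i
  exacts [h.1, h.2.1, h.2.2.1, h.2.2.2.1, h.2.2.2.2]

/-- A Lorentz orthonormal frame. -/
structure LorentzFrame (e : Fin 3 → Lor) (w : Lor) : Prop where
  space : ∀ i j, lorentz (e i) (e j) = if i = j then 1 else 0
  mixed : ∀ i, lorentz (e i) w = 0
  time : lorentz w w = -1

theorem LorentzFrame.mixed' {e : Fin 3 → Lor} {w : Lor} (h : LorentzFrame e w) (i : Fin 3) :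
    lorentz w (e i) = 0 := by rw [lorentz_comm, h.mixed]

/-- The difference `y` of the two sides is orthogonal to the frame. Five vectors are dependent, and
pairing a relation with the frame leaves only a nonzero multiple of `y`. -/
theorem LorentzFrame.expand {e : Fin 3 → Lor} {w : Lor} (h : LorentzFrame e w) (x : Lor) :
    x = lorentz x (e 0) • e 0 + lorentz x (e 1) • e 1 + lorentz x (e 2) • e 2
      - lorentz x w • w := by
  set y := x - (lorentz x (e 0) • e 0 + lorentz x (e 1) • e 1 + lorentz x (e 2) • e 2
      - lorentz x w • w) with hy
  have hye : ∀ i, lorentz y (e i) = 0 := by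
    intro i
    simp only [hy, lorentz_sub_left, lorentz_add_left, lorentz_smul_left, h.space, h.mixed']
    fin_cases i <;> simp
  have hyw : lorentz y w = 0 := by
    simp only [hy, lorentz_sub_left, lorentz_add_left, lorentz_smul_left, h.mixed, h.time]
    ring
  obtain ⟨a₀, a₁, a₂, a₃, a₄, hg, hne⟩ := exists_linear_relation y (e 0) (e 1) (e 2) w
  have key : ∀ z, a₀ * lorentz y z + a₁ * lorentz (e 0) z + a₂ * lorentz (e 1) z
      + a₃ * lorentz (e 2) z + a₄ * lorentz w z = 0 := by
    intro z
    rw [← lorentz_zero_left z, ← hg]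
    simp only [lorentz_add_left, lorentz_smul_left]
  have h1 := key (e 0)
  have h2 := key (e 1)
  have h3 := key (e 2)
  have h4 := key w
  simp [hye, hyw, h.space, h.mixed, h.mixed', h.time] at h1 h2 h3 h4
  rw [h1, h2, h3, h4] at hg
  simp only [zero_smul, add_zero] at hg
  have hg0 : a₀ ≠ 0 := fun h0 => hne ⟨h0, h1, h2, h3, h4⟩
  exact sub_eq_zero.1 ((smul_eq_zero.1 hg).resolve_left hg0)

theorem LorentzFrame.lorentz_self {e : Fin 3 → Lor} {w : Lor} (h : LorentzFrame e w) (x : Lor) :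
    lorentz x x = lorentz x (e 0) ^ 2 + lorentz x (e 1) ^ 2 + lorentz x (e 2) ^ 2
      - lorentz x w ^ 2 := by
  conv_lhs => rw [h.expand x, lorentz_comm]
  simp only [lorentz_sub_right, lorentz_add_right, lorentz_smul_right]
  rw [← h.expand x]
  ring

/-- The curvature functional is isotropic. -/
theorem LorentzFrame.sum_curvature_sq {e : Fin 3 → Lor} {w : Lor} (h : LorentzFrame e w) :
    e 0 0 ^ 2 + e 1 0 ^ 2 + e 2 0 ^ 2 = w 0 ^ 2 := by
  -- The null vector that represents the curvature.
  have hn : ∀ x, lorentz ![0, 0, 0, -2] x = x 0 := fun x => by simp [lorentz]; ring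
  have := h.lorentz_self ![0, 0, 0, -2]
  simp only [hn] at this
  simp at this
  linarith

theorem LorentzFrame.map {e : Fin 3 → Lor} {w : Lor} (h : LorentzFrame e w) {M : Lor ≃ₗ[ℝ] Lor}
    (hM : ∀ x y, lorentz (M x) (M y) = lorentz x y) : LorentzFrame (fun i => M (e i)) (M w) :=
  ⟨fun i j => by rw [hM, h.space], fun i => by rw [hM, h.mixed], by rw [hM, h.time]⟩

/-- The sign of a Boolean. -/
def boolSign (b : Bool) : ℝ := if b then 1 else -1

theorem boolSign_sq (b : Bool) : boolSign b ^ 2 = 1 := by cases b <;> norm_num [boolSign]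

theorem boolSign_not (b : Bool) : boolSign (!b) = -boolSign b := by
  cases b <;> norm_num [boolSign]

theorem exists_boolSign_mul_eq_abs (x : ℝ) : ∃ b, boolSign b * x = |x| := by
  rcases le_total 0 x with h | h
  · exact ⟨true, by rw [abs_of_nonneg h]; simp [boolSign]⟩
  · exact ⟨false, by rw [abs_of_nonpos h]; simp [boolSign]⟩

/-! ### Octahedral configurations -/

/-- The differences `d i` of opposite vectors are mutually orthogonal, non-isotropic because the `u
i b` span, and orthogonal to every sum `s j`. In dimension four the sums therefore lie on one line,
and their mutual products `-4` make them equal. -/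
theorem exists_octahedral_frame {u : Fin 3 → Bool → Lor} (hu : ∀ i b, lorentz (u i b) (u i b) = 1)
    (hadj : ∀ i j b c, i ≠ j → lorentz (u i b) (u j c) = -1)
    (hspan : ∀ y, (∀ i b, lorentz y (u i b) = 0) → y = 0) (hne : ∀ i, u i true ≠ u i false) :
    ∃ e w, LorentzFrame e w ∧ ∀ i b, u i b = w + (boolSign b * √2) • e i := by
  set d : Fin 3 → Lor := fun i => u i true - u i false with hd
  set s : Fin 3 → Lor := fun i => u i true + u i false with hs
  have hdu : ∀ i j b, i ≠ j → lorentz (d i) (u j b) = 0 := by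
    intro i j b hij
    simp only [hd, lorentz_sub_left, hadj _ _ _ _ hij, sub_self]
  have hdd : ∀ i j, i ≠ j → lorentz (d i) (d j) = 0 := by
    intro i j hij
    rw [hd]
    simp only [lorentz_sub_right]
    change lorentz (d i) _ - lorentz (d i) _ = 0
    rw [hdu _ _ _ hij, hdu _ _ _ hij, sub_self]
  have hds : ∀ i j, lorentz (d i) (s j) = 0 := by
    intro i j
    by_cases hij : i = j
    · subst hij
      simp only [hd, hs, lorentz_sub_left, lorentz_add_right, hu,
        lorentz_comm (u i false) (u i true)]
      ring
    · simp only [hs, lorentz_add_right, hdu _ _ _ hij, add_zero]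
  have hsd : ∀ i j, lorentz (s i) (d j) = 0 := fun i j => by rw [lorentz_comm, hds]
  have hss : ∀ i j, i ≠ j → lorentz (s i) (s j) = -4 := by
    intro i j hij
    simp only [hs, lorentz_add_left, lorentz_add_right, hadj _ _ _ _ hij]
    norm_num
  have hd0 : ∀ i, lorentz (d i) (d i) ≠ 0 := by
    intro i h
    refine hne i (sub_eq_zero.1 (hspan (d i) fun j b => ?_))
    by_cases hij : i = j
    · subst hij
      have h1 := hds i i
      simp only [hs, lorentz_add_right] at h1
      have h2 : lorentz (d i) (u i true) - lorentz (d i) (u i false) = 0 := by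
        rw [← lorentz_sub_right]; exact h
      cases b <;> linarith
    · exact hdu _ _ _ hij
  have heq : ∀ i j k : Fin 3, i ≠ j → i ≠ k → j ≠ k → s i = s j := by
    intro i j k hij hik hjk
    obtain ⟨a₀, a₁, a₂, a₃, a₄, hg, hgne⟩ :=
      exists_linear_relation (d 0) (d 1) (d 2) (s i) (s j)
    have key : ∀ z, a₀ * lorentz (d 0) z + a₁ * lorentz (d 1) z + a₂ * lorentz (d 2) z
        + a₃ * lorentz (s i) z + a₄ * lorentz (s j) z = 0 := by
      intro z
      rw [← lorentz_zero_left z, ← hg]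
      simp only [lorentz_add_left, lorentz_smul_left]
    have h0 := key (d 0)
    have h1 := key (d 1)
    have h2 := key (d 2)
    have h3 := key (s k)
    simp only [hsd, hds, hss _ _ hik, hss _ _ hjk] at h0 h1 h2 h3
    rw [hdd 1 0 (by decide), hdd 2 0 (by decide)] at h0
    rw [hdd 0 1 (by decide), hdd 2 1 (by decide)] at h1
    rw [hdd 0 2 (by decide), hdd 1 2 (by decide)] at h2
    replace h0 : a₀ = 0 := (mul_eq_zero.1 (by linarith : a₀ * _ = 0)).resolve_right (hd0 0)
    replace h1 : a₁ = 0 := (mul_eq_zero.1 (by linarith : a₁ * _ = 0)).resolve_right (hd0 1)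
    replace h2 : a₂ = 0 := (mul_eq_zero.1 (by linarith : a₂ * _ = 0)).resolve_right (hd0 2)
    have h4 : a₄ = -a₃ := by linarith
    rw [h0, h1, h2, h4] at hg
    have h5 : a₃ • (s i - s j) = 0 := by rw [← hg]; module
    have hg3 : a₃ ≠ 0 := fun h => hgne ⟨h0, h1, h2, h, by rw [h4, h, neg_zero]⟩
    exact sub_eq_zero.1 ((smul_eq_zero.1 h5).resolve_left hg3)
  have hs1 : s 1 = s 0 := heq 1 0 2 (by decide) (by decide) (by decide)
  have hs2 : s 2 = s 0 := heq 2 0 1 (by decide) (by decide) (by decide)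
  have hs0 : ∀ i, s i = s 0 := by
    intro i; fin_cases i
    · rfl
    · exact hs1
    · exact hs2
  have hsself : lorentz (s 0) (s 0) = -4 := by
    have := hss 1 0 (by decide)
    rwa [hs1] at this
  have hdself : ∀ i, lorentz (d i) (d i) = 8 := by
    intro i
    have h1 : lorentz (s i) (s i) = -4 := by rw [hs0, hsself]
    simp only [hs, hd, lorentz_add_left, lorentz_add_right, lorentz_sub_left, lorentz_sub_right,
      hu, lorentz_comm (u i false) (u i true)] at h1 ⊢
    linarith
  have h2 : √2 * √2 = 2 := Real.mul_self_sqrt (by norm_num)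
  -- Normalization: `d i` has norm 8 and `s 0` has norm `-4`.
  refine ⟨fun i => (√2 / 4) • d i, (1 / 2 : ℝ) • s 0, ⟨fun i j => ?_, fun i => ?_, ?_⟩,
    fun i b => ?_⟩
  · rw [lorentz_smul_left, lorentz_smul_right]
    by_cases hij : i = j
    · subst hij
      rw [hdself, if_pos rfl]
      linarith
    · rw [hdd _ _ hij, if_neg hij]; ring
  · rw [lorentz_smul_left, lorentz_smul_right, hds]; ring
  · rw [lorentz_smul_left, lorentz_smul_right, hsself]; norm_num
  · rw [← hs0 i, smul_smul, show boolSign b * √2 * (√2 / 4) = boolSign b * (√2 * √2) / 4 by ring,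
      h2]
    simp only [hs, hd]
    cases b <;> simp [boolSign] <;> module

/-- Each axis carries a tight vertex: otherwise `e i`, orthogonal to the vertices on the other axes,
would vanish on every tight vertex and be a multiple of `F`, impossible since `F` is not orthogonal
to `w`. One tight vertex per axis fixes `F` up to scale. -/
theorem octahedral_dual {e : Fin 3 → Lor} {w F : Lor} (h : LorentzFrame e w) {u : Fin 3 → Bool → Lor}
    (hu : ∀ i b, u i b = w + (boolSign b * √2) • e i) (hF : F ≠ 0)
    (hle : ∀ i b, lorentz F (u i b) ≤ 0)
    (hrank : ∀ z, (∀ i b, lorentz F (u i b) = 0 → lorentz z (u i b) = 0) → ∃ c : ℝ, z = c • F) :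
    ∃ σ : Fin 3 → Bool, ∃ k : ℝ, 0 < k ∧ F = k • (u 0 (σ 0) + u 1 (σ 1) + u 2 (σ 2) - w) := by
  have h2 : √2 * √2 = 2 := Real.mul_self_sqrt (by norm_num)
  have h2' : 0 < √2 := by positivity
  have hFu : ∀ i b, lorentz F (u i b) = lorentz F w + boolSign b * √2 * lorentz F (e i) := by
    intro i b; rw [hu, lorentz_add_right, lorentz_smul_right]
  have hφle : lorentz F w ≤ 0 := by
    have h1 := hle 0 true
    have h3 := hle 0 false
    simp [hFu, boolSign] at h1 h3
    linarith
  have hφ : lorentz F w ≠ 0 := by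
    intro h0
    have he : ∀ i, lorentz F (e i) = 0 := by
      intro i
      have h1 := hle i true
      have h3 := hle i false
      simp [hFu, boolSign, h0] at h1 h3
      nlinarith
    refine hF ?_
    rw [h.expand F, he, he, he, h0]
    simp
  have hex : ∀ i, ∃ b, lorentz F (u i b) = 0 := by
    intro i
    by_contra! hcon
    obtain ⟨c, hc⟩ := hrank (e i) (by
      intro j b hjb
      have hij : i ≠ j := by
        rintro rfl; exact hcon b hjb
      rw [hu, lorentz_add_right, lorentz_smul_right, h.mixed, h.space, if_neg hij]
      ring)
    have h0 := h.mixed i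
    rw [hc, lorentz_smul_left] at h0
    have h1 := h.space i i
    rw [hc, (mul_eq_zero.1 h0).resolve_right hφ] at h1
    simp [lorentz_zero_left] at h1
  choose σ hσ using hex
  refine ⟨σ, -lorentz F w / 2, ?_, ?_⟩
  · have := hφle.lt_of_ne hφ
    linarith
  · have hf : ∀ i, lorentz F (e i) = -lorentz F w / 2 * (boolSign (σ i) * √2) := by
      intro i
      have := hσ i
      rw [hFu] at this
      have hb := boolSign_sq (σ i)
      have : √2 * boolSign (σ i) * (lorentz F w + boolSign (σ i) * √2 * lorentz F (e i)) = 0 := by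
        rw [this, mul_zero]
      linear_combination this / 2 - lorentz F (e i) / 2 * (√2 * √2 * hb + h2)
    conv_lhs => rw [h.expand F, hf, hf, hf]
    rw [hu, hu, hu]
    module

/-! ### Cubical configurations -/

theorem exists_neg_mul_eq {n m x z : ℝ} (hn : n < 0) (hm : m < 0) (h : x * n + z * m = 0) :
    ∃ r : ℝ, 0 < r ∧ z = -r * x :=
  ⟨n / m, div_pos_of_neg_of_neg hn hm, by have := hm.ne; field_simp; linarith⟩

/-- Four independent vectors would span, and `y` would be orthogonal to everything. -/
theorem exists_relation_of_lorentz_eq_zero {y : Lor} (hy : y ≠ 0) (f : Fin 4 → Lor)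
    (hf : ∀ i, lorentz y (f i) = 0) : ∃ g : Fin 4 → ℝ, ∑ i, g i • f i = 0 ∧ ∃ i, g i ≠ 0 := by
  refine Fintype.not_linearIndependent_iff.1 fun h => hy (eq_zero_of_lorentz_eq_zero fun z => ?_)
  have htop := h.span_eq_top_of_card_eq_finrank' (by simp)
  have hz : z ∈ Submodule.span ℝ (Set.range f) := by rw [htop]; trivial
  induction hz using Submodule.span_induction with
  | mem x hx => obtain ⟨i, rfl⟩ := hx; exact hf i
  | zero => exact lorentz_zero_right y
  | add x z _ _ hx hz => rw [lorentz_add_right, hx, hz, add_zero]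
  | smul a x _ hx => rw [lorentz_smul_right, hx, mul_zero]

/-- Two opposite pairs of a quadrangle of tangent disks with a common orthogonal vector: their sums
are proportional. -/
theorem quadrangle_relation {a b p q y y₁ y₂ y₃ : Lor} (ha : lorentz a a = 1) (hb : lorentz b b = 1)
    (hp : lorentz p p = 1) (hq : lorentz q q = 1) (hap : lorentz a p = -1) (haq : lorentz a q = -1)
    (hbp : lorentz b p = -1) (hbq : lorentz b q = -1) (hy : y ≠ 0)
    (h0 : lorentz y a = 0 ∧ lorentz y b = 0 ∧ lorentz y p = 0 ∧ lorentz y q = 0)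
    (h1 : lorentz y₁ b = 0 ∧ lorentz y₁ p = 0 ∧ lorentz y₁ a < 0 ∧ lorentz y₁ q < 0)
    (h2 : lorentz y₂ b = 0 ∧ lorentz y₂ q = 0 ∧ lorentz y₂ a < 0 ∧ lorentz y₂ p < 0)
    (h3 : lorentz y₃ a = 0 ∧ lorentz y₃ q = 0 ∧ lorentz y₃ p < 0 ∧ lorentz y₃ b < 0) :
    ∃ t : ℝ, 0 < t ∧ a + b = t • (p + q) := by
  obtain ⟨g, hg, hne⟩ := exists_relation_of_lorentz_eq_zero hy ![a, b, p, q] (by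
    intro i; fin_cases i
    · exact h0.1
    · exact h0.2.1
    · exact h0.2.2.1
    · exact h0.2.2.2)
  simp only [Fin.sum_univ_four, Matrix.cons_val] at hg
  have key : ∀ z, g 0 * lorentz z a + g 1 * lorentz z b + g 2 * lorentz z p
      + g 3 * lorentz z q = 0 := by
    intro z
    rw [← lorentz_zero_right z, ← hg]
    simp only [lorentz_add_right, lorentz_smul_right]
  have k1 := key y₁
  have k2 := key y₂
  have k3 := key y₃
  rw [h1.1, h1.2.1] at k1
  rw [h2.1, h2.2.1] at k2
  rw [h3.1, h3.2.1] at k3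
  -- The three neighbouring faces fix the signs of the relation: `a` and `b` on one side, `p` and
  -- `q` on the other.
  obtain ⟨r, hr, e3⟩ := exists_neg_mul_eq h1.2.2.1 h1.2.2.2 (by linarith : g 0 * _ + g 3 * _ = 0)
  obtain ⟨s, hs, e2⟩ := exists_neg_mul_eq h2.2.2.1 h2.2.2.2 (by linarith : g 0 * _ + g 2 * _ = 0)
  obtain ⟨t, ht, e1⟩ := exists_neg_mul_eq h3.2.2.1 h3.2.2.2 (by linarith : g 2 * _ + g 1 * _ = 0)
  have hg0 : g 0 ≠ 0 := by
    intro h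
    rw [h, mul_zero] at e2 e3
    rw [e2, mul_zero] at e1
    obtain ⟨i, hi⟩ := hne
    fin_cases i <;> simp_all
  have ka := key a
  have kb := key b
  have kp := key p
  have kq := key q
  rw [ha, hap, haq] at ka
  rw [lorentz_comm b a, hb, hbp, hbq] at kb
  rw [lorentz_comm p a, lorentz_comm p b, hap, hbp, hp] at kp
  rw [lorentz_comm q a, lorentz_comm q b, lorentz_comm q p, haq, hbq, hq] at kq
  have hpos : 0 < 1 + t * s + s + r := by positivity
  have hab : lorentz a b ≠ 1 := by
    intro h
    rw [h, e1, e3, e2] at ka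
    have : g 0 * (1 + t * s + s + r) = 0 := by linarith
    exact (mul_ne_zero hg0 hpos.ne') this
  have hpq : lorentz p q ≠ 1 := by
    intro h
    rw [h, e1, e3, e2] at kp
    have : g 0 * (1 + t * s + s + r) = 0 := by linarith
    exact (mul_ne_zero hg0 hpos.ne') this
  -- Subtracting the pairings with `a` and `b` leaves `(g 1 - g 0) (⟨a, b⟩ - 1) = 0`.
  have e01 : g 1 = g 0 := by
    have : (g 1 - g 0) * (lorentz a b - 1) = 0 := by linarith
    linarith [(mul_eq_zero.1 this).resolve_right (sub_ne_zero.2 hab)]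
  have e23 : g 3 = g 2 := by
    have : (g 3 - g 2) * (lorentz p q - 1) = 0 := by linarith
    linarith [(mul_eq_zero.1 this).resolve_right (sub_ne_zero.2 hpq)]
  refine ⟨s, hs, ?_⟩
  rw [e23, e01, e2] at hg
  have : g 0 • (a + b - s • (p + q)) = 0 := by rw [← hg]; module
  exact sub_eq_zero.1 ((smul_eq_zero.1 this).resolve_left hg0)

/-- The two colour classes of the vertices of a cube of tangent disks: the class of `E` is determined
by the class of `O`. -/
theorem cube_colour_classes {E O : Fin 4 → Lor} (hE : ∀ i, lorentz (E i) (E i) = 1)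
    (hO : ∀ i, lorentz (O i) (O i) = 1) (hEO : ∀ i j, i ≠ j → lorentz (E i) (O j) = -1)
    (hface : ∀ i j, i ≠ j → ∃ y, lorentz y (E i) = 0 ∧ lorentz y (E j) = 0 ∧
      (∀ k, k ≠ i → k ≠ j → lorentz y (E k) < 0) ∧ lorentz y (O i) < 0 ∧ lorentz y (O j) < 0 ∧
      (∀ k, k ≠ i → k ≠ j → lorentz y (O k) = 0)) :
    (∀ i j, i ≠ j → lorentz (O i) (O j) = -3) ∧
      ∀ i, E i = (1 / 2 : ℝ) • (O 0 + O 1 + O 2 + O 3) - O i := by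
  -- `O i` plays the antipode of `E i`, so `E i, E j, O k, O l` form a face; `y` cuts it out, and
  -- the other three vectors come from adjacent faces.
  have hquad : ∀ i j k l : Fin 4, i ≠ j → i ≠ k → i ≠ l → j ≠ k → j ≠ l → k ≠ l →
      ∃ t : ℝ, 0 < t ∧ E i + E j = t • (O k + O l) := by
    intro i j k l hij hik hil hjk hjl hkl
    obtain ⟨y, hy1, hy2, -, hy3, -, hy4⟩ := hface i j hij
    obtain ⟨y₁, a1, a2, a3, a4, a5, a6⟩ := hface j l hjl
    obtain ⟨y₂, b1, b2, b3, b4, b5, b6⟩ := hface j k hjk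
    obtain ⟨y₃, c1, c2, c3, c4, c5, c6⟩ := hface i k hik
    refine quadrangle_relation (y := y) (y₁ := y₁) (y₂ := y₂) (y₃ := y₃) (hE i) (hE j) (hO k) (hO l)
      (hEO _ _ hik) (hEO _ _ hil) (hEO _ _ hjk) (hEO _ _ hjl) ?_
      ⟨hy1, hy2, hy4 _ hik.symm hjk.symm, hy4 _ hil.symm hjl.symm⟩
      ⟨a1, a6 _ hjk.symm hkl, a3 _ hij hil, a5⟩ ⟨b1, b6 _ hjl.symm hkl.symm, b3 _ hij hik, b5⟩
      ⟨c1, c6 _ hil.symm hkl.symm, c5, c3 _ hij.symm hjk⟩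
    rintro rfl
    rw [lorentz_zero_left] at hy3
    exact lt_irrefl _ hy3
  -- The face through `O i` and `O j` but not the other two makes `x i` and `x j` of opposite sign
  -- or both zero; three coefficients cannot pairwise be of opposite sign.
  have hind : ∀ x : Fin 4 → ℝ, x 0 • O 0 + x 1 • O 1 + x 2 • O 2 + x 3 • O 3 = 0 →
      ∀ i, x i = 0 := by
    intro x hx
    have hpair : ∀ i j, i ≠ j → ∃ r : ℝ, 0 < r ∧ x j = -r * x i := by
      intro i j hij
      obtain ⟨y, -, -, -, hi, hj, hk⟩ := hface i j hij
      refine exists_neg_mul_eq hi hj ?_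
      have hsum : ∑ k, x k * lorentz y (O k) = 0 := by
        rw [Fin.sum_univ_four, ← lorentz_zero_right y, ← hx]
        simp only [lorentz_add_right, lorentz_smul_right]
      rwa [Fintype.sum_eq_add i j hij fun k hk' => by rw [hk k hk'.1 hk'.2, mul_zero]] at hsum
    intro i
    obtain ⟨j, k, hij, hik, hjk⟩ : ∃ j k : Fin 4, i ≠ j ∧ i ≠ k ∧ j ≠ k := by
      revert i; decide
    obtain ⟨r, hr, e1⟩ := hpair i j hij
    obtain ⟨s, hs, e2⟩ := hpair i k hik
    obtain ⟨t, ht, e3⟩ := hpair j k hjk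
    have : x i * (t * r + s) = 0 := by rw [e1] at e3; linarith
    exact (mul_eq_zero.1 this).resolve_right (by positivity)
  obtain ⟨t01, ht, q01⟩ := hquad 0 1 2 3 (by decide) (by decide) (by decide) (by decide) (by decide)
    (by decide)
  obtain ⟨t23, -, q23⟩ := hquad 2 3 0 1 (by decide) (by decide) (by decide) (by decide) (by decide)
    (by decide)
  obtain ⟨t02, -, q02⟩ := hquad 0 2 1 3 (by decide) (by decide) (by decide) (by decide) (by decide)
    (by decide)
  obtain ⟨t13, -, q13⟩ := hquad 1 3 0 2 (by decide) (by decide) (by decide) (by decide) (by decide)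
    (by decide)
  obtain ⟨t03, -, q03⟩ := hquad 0 3 1 2 (by decide) (by decide) (by decide) (by decide) (by decide)
    (by decide)
  obtain ⟨t12, -, q12⟩ := hquad 1 2 0 3 (by decide) (by decide) (by decide) (by decide) (by decide)
    (by decide)
  -- The sum of all `E i` can be paired off in three ways; independence of the `O i` then equates
  -- the six factors.
  have r1 := hind ![t23 - t13, t23 - t02, t01 - t13, t01 - t02] (by
    simp only [Matrix.cons_val]
    have : (t01 • (O 2 + O 3) + t23 • (O 0 + O 1)) - (t02 • (O 1 + O 3) + t13 • (O 0 + O 2)) = 0 := by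
      rw [← q01, ← q23, ← q02, ← q13]; abel
    rw [← this]; module)
  have r2 := hind ![t23 - t12, t23 - t03, t01 - t03, t01 - t12] (by
    simp only [Matrix.cons_val]
    have : (t01 • (O 2 + O 3) + t23 • (O 0 + O 1)) - (t03 • (O 1 + O 2) + t12 • (O 0 + O 3)) = 0 := by
      rw [← q01, ← q23, ← q03, ← q12]; abel
    rw [← this]; module)
  obtain rfl : t02 = t01 := by have := r1 3; simp at this; linarith
  obtain rfl : t13 = t02 := by have := r1 2; simp at this; linarith
  obtain rfl : t23 = t13 := by have := r1 0; simp at this; linarith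
  obtain rfl : t12 = t23 := by have := r2 3; simp at this; linarith
  obtain rfl : t03 = t12 := by have := r2 2; simp at this; linarith
  set t := t03
  have hEt : ∀ i, (2 : ℝ) • E i = t • ((O 0 + O 1 + O 2 + O 3) - (2 : ℝ) • O i) := by
    intro i
    fin_cases i
    · have : (2 : ℝ) • E 0 = (E 0 + E 1) + (E 0 + E 2) - (E 1 + E 2) := by module
      simp only [Fin.zero_eta]
      rw [this, q01, q02, q12]; module
    · have : (2 : ℝ) • E 1 = (E 0 + E 1) + (E 1 + E 2) - (E 0 + E 2) := by module
      simp only [Fin.mk_one]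
      rw [this, q01, q02, q12]; module
    · have : (2 : ℝ) • E 2 = (E 0 + E 2) + (E 1 + E 2) - (E 0 + E 1) := by module
      simp only [Fin.reduceFinMk]
      rw [this, q01, q02, q12]; module
    · have : (2 : ℝ) • E 3 = (E 0 + E 3) + (E 1 + E 3) - (E 0 + E 1) := by module
      simp only [Fin.reduceFinMk]
      rw [this, q01, q03, q13]; module
  have hx : ∀ i j, i ≠ j →
      t * (lorentz (O 0 + O 1 + O 2 + O 3) (O j) - 2 * lorentz (O i) (O j)) = -2 := by
    intro i j hij
    rw [← lorentz_smul_left, ← lorentz_sub_left, ← lorentz_smul_left, ← hEt, lorentz_smul_left,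
      hEO _ _ hij]
    norm_num
  have hcol : ∀ i j, i ≠ j → t * (1 + lorentz (O i) (O j)) = -2 := by
    intro i j hij
    have h0 : ∀ k, k ≠ j → t * lorentz (O k) (O j) = t * lorentz (O i) (O j) := by
      intro k hk
      have h1 := hx k j hk
      have h2 := hx i j hij
      linarith
    have hsum : t * lorentz (O 0 + O 1 + O 2 + O 3) (O j) = t + 3 * (t * lorentz (O i) (O j)) := by
      simp only [lorentz_add_left, mul_add]
      obtain rfl | rfl | rfl | rfl : j = 0 ∨ j = 1 ∨ j = 2 ∨ j = 3 := by omega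
      · rw [hO, h0 1 (by decide), h0 2 (by decide), h0 3 (by decide)]; ring
      · rw [hO, h0 0 (by decide), h0 2 (by decide), h0 3 (by decide)]; ring
      · rw [hO, h0 0 (by decide), h0 1 (by decide), h0 3 (by decide)]; ring
      · rw [hO, h0 0 (by decide), h0 1 (by decide), h0 2 (by decide)]; ring
    have h2 := hx i j hij
    rw [mul_sub, hsum] at h2
    linarith
  -- As the products `⟨O i, O j⟩` are all equal, they cancel in the norm of `2 E 0`, leaving `4 t² =
  -- 4`.
  have ht1 : t = 1 := by
    have h4 : lorentz ((2 : ℝ) • E 0) ((2 : ℝ) • E 0) = 4 := by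
      rw [lorentz_smul_left, lorentz_smul_right, hE]; norm_num
    rw [hEt] at h4
    have c01 := hcol 0 1 (by decide)
    have c02 := hcol 0 2 (by decide)
    have c03 := hcol 0 3 (by decide)
    have c12 := hcol 1 2 (by decide)
    have c13 := hcol 1 3 (by decide)
    have c23 := hcol 2 3 (by decide)
    simp only [lorentz_smul_left, lorentz_smul_right, lorentz_sub_left, lorentz_sub_right,
      lorentz_add_left, lorentz_add_right, hO, lorentz_comm (O 1) (O 0), lorentz_comm (O 2) (O 0),
      lorentz_comm (O 3) (O 0), lorentz_comm (O 2) (O 1), lorentz_comm (O 3) (O 1),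
      lorentz_comm (O 3) (O 2)] at h4
    have : t ^ 2 = 1 := by
      linear_combination h4 / 4 + t / 2 * (c01 + c02 + c03) - t / 2 * (c12 + c13 + c23)
    nlinarith
  rw [ht1] at hEt hcol
  refine ⟨fun i j hij => by linarith [hcol i j hij], fun i => ?_⟩
  refine smul_right_injective Lor (two_ne_zero (α := ℝ)) ?_
  change (2 : ℝ) • E i = (2 : ℝ) • _
  rw [hEt]; module

/-- One colour class of the vertices of a cube. -/
def evenVertex : Fin 4 → Fin 3 → Bool :=
  ![![true, true, true], ![true, false, false], ![false, true, false], ![false, false, true]]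

/-- The other colour class of the vertices of a cube. -/
def oddVertex (i : Fin 4) (j : Fin 3) : Bool := !evenVertex i j

/-- The vertices split into two tetrahedral colour classes, `oddVertex i` being antipodal to
`evenVertex i`. By `cube_colour_classes` the odd class has a known Gram matrix and determines the
even one, so the frame is built from the odd class alone. -/
theorem exists_cubical_frame {c : (Fin 3 → Bool) → Lor} (hc : ∀ s, lorentz (c s) (c s) = 1)
    (hadj : ∀ s a, lorentz (c s) (c (Function.update s a (!s a))) = -1)
    (hface : ∀ a b, ∃ y, (∀ s, s a = b → lorentz y (c s) = 0) ∧
      ∀ s, s a ≠ b → lorentz y (c s) < 0) :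
    ∃ e w, LorentzFrame e w ∧ ∀ s, c s = √2 • w + (boolSign (s 0) • e 0 + boolSign (s 1) • e 1
      + boolSign (s 2) • e 2) := by
  have hnbr : ∀ i j, i ≠ j →
      ∃ a, oddVertex j = Function.update (evenVertex i) a (!evenVertex i a) := by decide
  have hfaces : ∀ i j, i ≠ j → ∃ a b, evenVertex i a = b ∧ evenVertex j a = b ∧
      (∀ k, k ≠ i → k ≠ j → evenVertex k a ≠ b) ∧ oddVertex i a ≠ b ∧ oddVertex j a ≠ b ∧
      (∀ k, k ≠ i → k ≠ j → oddVertex k a = b) := by decide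
  obtain ⟨hOO, hE⟩ := cube_colour_classes (E := fun i => c (evenVertex i))
    (O := fun i => c (oddVertex i)) (fun _ => hc _) (fun _ => hc _)
    (fun i j hij => by
      obtain ⟨a, ha⟩ := hnbr i j hij
      rw [ha, hadj])
    (fun i j hij => by
      obtain ⟨a, b, h1, h2, h3, h4, h5, h6⟩ := hfaces i j hij
      obtain ⟨y, hy, hy'⟩ := hface a b
      exact ⟨y, hy _ h1, hy _ h2, fun k hk hk' => hy' _ (h3 k hk hk'), hy' _ h4, hy' _ h5,
        fun k hk hk' => hy _ (h6 k hk hk')⟩)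
  have hval : ∀ s, ∃ i, s = evenVertex i ∨ s = oddVertex i := by decide
  obtain ⟨O, hO⟩ : ∃ O : Fin 4 → Lor, ∀ i, c (oddVertex i) = O i := ⟨_, fun _ => rfl⟩
  have hOself : ∀ i, lorentz (O i) (O i) = 1 := fun i => by rw [← hO, hc]
  simp only [hO] at hOO hE
  have hpair : ∀ i j, lorentz (O i) (O j) = if i = j then 1 else -3 := by
    intro i j
    split_ifs with h
    · rw [h, hOself]
    · exact hOO i j h
  have h2 : √2 * √2 = 2 := Real.mul_self_sqrt (by norm_num)
  set W : Lor := (1 / 4 : ℝ) • (O 0 + O 1 + O 2 + O 3) with hW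
  have hWO : ∀ i, lorentz W (O i) = -2 := by
    intro i
    rw [hW]
    simp only [lorentz_smul_left, lorentz_add_left, hpair]
    fin_cases i <;> simp <;> norm_num
  have hWW : lorentz W W = -2 := by
    have : lorentz W ((1 / 4 : ℝ) • (O 0 + O 1 + O 2 + O 3)) = -2 := by
      simp only [lorentz_smul_right, lorentz_add_right, hWO]
      norm_num
    rwa [← hW] at this
  clear_value W
  -- Odd vertices `0` and `i + 1` agree only in coordinate `i`, where both are negative, so half
  -- their sum is `W - e i`.
  refine ⟨fun i => W - (1 / 2 : ℝ) • (O 0 + O i.succ), (√2 / 2) • W,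
    ⟨fun i j => ?_, fun i => ?_, ?_⟩, fun s => ?_⟩
  · simp only [lorentz_sub_left, lorentz_sub_right, lorentz_smul_left, lorentz_smul_right,
      lorentz_add_left, lorentz_add_right, hWW, hWO, hpair, lorentz_comm (O _) W, Fin.succ_inj,
      (Fin.succ_ne_zero _), (Fin.succ_ne_zero _).symm, if_true, if_false]
    split_ifs <;> norm_num
  · simp only [lorentz_sub_left, lorentz_smul_left, lorentz_smul_right,
      lorentz_add_left, hWW, hWO, lorentz_comm (O _) W]
    ring
  · rw [lorentz_smul_left, lorentz_smul_right, hWW]; linarith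
  · rw [smul_smul, show √2 * (√2 / 2) = 1 by linarith, one_smul]
    simp only [show (Fin.succ (0 : Fin 3)) = (1 : Fin 4) from rfl,
      show (Fin.succ (1 : Fin 3)) = (2 : Fin 4) from rfl,
      show (Fin.succ (2 : Fin 3)) = (3 : Fin 4) from rfl]
    obtain ⟨i, rfl | rfl⟩ := hval s
    · rw [hE]
      have hs : O 0 + O 1 + O 2 + O 3 = (4 : ℝ) • W := by rw [hW]; module
      have hO3 : O 3 = (4 : ℝ) • W - O 0 - O 1 - O 2 := by rw [← hs]; abel
      rw [hs]
      fin_cases i <;> simp [evenVertex, boolSign, hO3] <;> module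
    · rw [hO]
      have hs : O 0 + O 1 + O 2 + O 3 = (4 : ℝ) • W := by rw [hW]; module
      have hO3 : O 3 = (4 : ℝ) • W - O 0 - O 1 - O 2 := by rw [← hs]; abel
      fin_cases i <;> simp [oddVertex, evenVertex, boolSign, hO3] <;> module

/-- The largest product of `F` with a vertex is `√2 ⟨F, w⟩ + ∑ |⟨F, e i⟩|`, and a tight vertex has
its signs prescribed wherever `⟨F, e i⟩ ≠ 0`. The rank condition leaves exactly one such index,
which names a face of the cube. -/
theorem cubical_dual {e : Fin 3 → Lor} {w F : Lor} (h : LorentzFrame e w)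
    {c : (Fin 3 → Bool) → Lor} (hc : ∀ s, c s = √2 • w + (boolSign (s 0) • e 0
      + boolSign (s 1) • e 1 + boolSign (s 2) • e 2)) (hF : F ≠ 0)
    (hle : ∀ s, lorentz F (c s) ≤ 0)
    (hrank : ∀ z, (∀ s, lorentz F (c s) = 0 → lorentz z (c s) = 0) → ∃ k : ℝ, z = k • F) :
    ∃ i b, ∃ k : ℝ, 0 < k ∧ F = k • (√2 • w + (2 * boolSign b) • e i) := by
  have h2 : √2 * √2 = 2 := Real.mul_self_sqrt (by norm_num)
  have h2' : 0 < √2 := by positivity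
  have hzc : ∀ z s, lorentz z (c s) = √2 * lorentz z w + ∑ i, boolSign (s i) * lorentz z (e i) := by
    intro z s
    rw [hc, Fin.sum_univ_three]
    simp only [lorentz_add_right, lorentz_smul_right]
  choose σ hσ using fun i => exists_boolSign_mul_eq_abs (lorentz F (e i))
  have habs : ∀ (b : Bool) (x : ℝ), boolSign b * x ≤ |x| := by
    intro b x
    cases b
    · simpa [boolSign] using neg_le_abs x
    · simpa [boolSign] using le_abs_self x
  have hmax : ∑ i, |lorentz F (e i)| ≤ -√2 * lorentz F w := by
    have := hle σ
    simp only [hzc, hσ] at this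
    linarith
  have hsum0 : 0 ≤ ∑ i, |lorentz F (e i)| := Finset.sum_nonneg fun i _ => abs_nonneg _
  have hφ : lorentz F w ≠ 0 := by
    intro h0
    have he : ∀ i, lorentz F (e i) = 0 := by
      intro i
      have := (Finset.sum_eq_zero_iff_of_nonneg fun i _ => abs_nonneg (lorentz F (e i))).1
        (le_antisymm (by rw [h0, mul_zero] at hmax; exact hmax) hsum0) i (Finset.mem_univ i)
      exact abs_eq_zero.1 this
    refine hF ?_
    rw [h.expand F, he, he, he, h0]
    simp
  have hφneg : lorentz F w < 0 := lt_of_le_of_ne (by nlinarith) hφ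
  have htight : ∀ s, lorentz F (c s) = 0 → ∀ i, boolSign (s i) * lorentz F (e i)
      = |lorentz F (e i)| := by
    intro s hs i
    rw [hzc] at hs
    have hsum : ∑ i, (|lorentz F (e i)| - boolSign (s i) * lorentz F (e i)) = 0 := by
      refine le_antisymm ?_ (Finset.sum_nonneg fun i _ => sub_nonneg.2 (habs _ _))
      rw [Finset.sum_sub_distrib]; linarith
    have := (Finset.sum_eq_zero_iff_of_nonneg fun i _ => sub_nonneg.2 (habs _ _)).1 hsum i
      (Finset.mem_univ i)
    linarith
  have hone : ∀ i, lorentz (e i) (e i) = 1 := fun i => by rw [h.space, if_pos rfl]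
  obtain ⟨s, hs⟩ : ∃ s, lorentz F (c s) = 0 := by
    by_contra! hcon
    obtain ⟨k, hk⟩ := hrank (e 0) fun s hs => absurd hs (hcon s)
    have h0 := h.mixed 0
    rw [hk, lorentz_smul_left] at h0
    have h1 := hone 0
    rw [hk, (mul_eq_zero.1 h0).resolve_right hφ] at h1
    simp [lorentz_zero_left] at h1
  have hpair : ∀ i j, i ≠ j → lorentz F (e i) ≠ 0 → lorentz F (e j) = 0 := by
    intro i j hij hi
    by_contra hj
    -- On tight vertices the sign in coordinate `i` is constant, so this vector vanishes there;
    -- being orthogonal to `e j`, it is not a multiple of `F`.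
    obtain ⟨k, hk⟩ := hrank (e i + (boolSign (s i) * √2 / 2) • w) (by
      intro s' hs'
      have h1 : boolSign (s' i) = boolSign (s i) :=
        mul_right_cancel₀ hi ((htight s' hs' i).trans (htight s hs i).symm)
      rw [hzc]
      simp only [lorentz_add_left, lorentz_smul_left, h.mixed, h.time, h.mixed', h.space]
      simp [h1]
      linear_combination (-boolSign (s i) / 2) * h2)
    have hz : ∀ m, lorentz (e i + (boolSign (s i) * √2 / 2) • w) (e m) = if i = m then 1 else 0 := by
      intro m
      simp only [lorentz_add_left, lorentz_smul_left, h.mixed', h.space]; ring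
    have hj' := hz j
    rw [hk, lorentz_smul_left, if_neg hij] at hj'
    have hi' := hz i
    rw [hk, lorentz_smul_left, if_pos rfl, (mul_eq_zero.1 hj').resolve_right hj] at hi'
    simp at hi'
  obtain ⟨i, hi⟩ : ∃ i, lorentz F (e i) ≠ 0 := by
    by_contra! hcon
    rw [hzc] at hs
    simp [hcon] at hs
    exact hφ hs
  rw [hzc, Finset.sum_eq_single i (fun j _ hj => by rw [hpair i j hj.symm hi, mul_zero])
    (by simp)] at hs
  have hb := boolSign_sq (s i)
  have hfi : lorentz F (e i) = -(lorentz F w) * √2 / 2 * (2 * boolSign (s i)) := by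
    linear_combination boolSign (s i) * hs - lorentz F (e i) * hb
  refine ⟨i, s i, -(lorentz F w) * √2 / 2, by
    have := mul_pos (neg_pos.2 hφneg) h2'
    linarith, ?_⟩
  have hexp : F = lorentz F (e i) • e i - lorentz F w • w := by
    conv_lhs => rw [h.expand F]
    obtain rfl | rfl | rfl : i = 0 ∨ i = 1 ∨ i = 2 := by omega
    · rw [hpair 0 1 (by decide) hi, hpair 0 2 (by decide) hi]; module
    · rw [hpair 1 0 (by decide) hi, hpair 1 2 (by decide) hi]; module
    · rw [hpair 2 0 (by decide) hi, hpair 2 1 (by decide) hi]; module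
  conv_lhs => rw [hexp, hfi]
  rw [smul_add, smul_smul, smul_smul, show -lorentz F w * √2 / 2 * √2 = -lorentz F w by
    linear_combination (-lorentz F w / 2) * h2]
  module

/-! ### Packings -/

theorem mem_packing {P : Set Space} (hP : IsEdgeScribed P) {μ : Equiv.Perm ExtPlane}
    {M : Lor ≃ₗ[ℝ] Lor} (hM : Induces M μ) {D : Disk} :
    D ∈ packing P μ ↔ ∃ v ∈ vertices P, D.vec = M (capVec v) := by
  constructor
  · rintro ⟨E, ⟨v, hv, hE⟩, hD⟩
    refine ⟨v, hv, Disk.vec_eq_of_carrier_eq ?_ ?_⟩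
    · rw [hM.lorentz_map, lorentz_capVec_self (hP.outside v hv)]
    · rw [hD, hE, ← region_capVec (hP.outside v hv), hM.image_region]
  · rintro ⟨v, hv, hD⟩
    obtain ⟨E, hE⟩ := Disk.exists_vec_eq (lorentz_capVec_self (hP.outside v hv))
    refine ⟨E, ⟨v, hv, ?_⟩, ?_⟩
    · rw [E.carrier_eq_region, hE, region_capVec (hP.outside v hv)]
    · rw [E.carrier_eq_region, hE, hM.image_region, ← hD, D.carrier_eq_region]

theorem packing_subset_apollonianPacking (P : Set Space) (μ : Equiv.Perm ExtPlane) :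
    packing P μ ⊆ apollonianPacking P μ := fun D hD =>
  ⟨1, one_mem _, D, hD, by simp⟩

/-- Every vertex of the polytope gives a disk of the packing. -/
theorem exists_mem_packing {P : Set Space} (hP : IsEdgeScribed P) {μ : Equiv.Perm ExtPlane}
    {M : Lor ≃ₗ[ℝ] Lor} (hM : Induces M μ) {v : Space} (hv : v ∈ vertices P) :
    ∃ D ∈ packing P μ, D.curvature = M (capVec v) 0 := by
  obtain ⟨D, hD⟩ := Disk.exists_vec_eq (x := M (capVec v))
    (by rw [hM.lorentz_map, lorentz_capVec_self (hP.outside v hv)])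
  exact ⟨D, (mem_packing hP hM).2 ⟨v, hv, hD⟩, by rw [← D.vec_zero, hD]⟩

/-- The inequality suffices: among distinct vertices of either polyhedron, nonadjacent ones turn out
to have product at most `-3`. -/
theorem Tangent.lorentz_ge {D E : Disk} (h : Tangent D E) {μ : Equiv.Perm ExtPlane}
    {M : Lor ≃ₗ[ℝ] Lor} (hM : Induces M μ) {v w : Space} (hv : 1 < ‖v‖) (hw : 1 < ‖w‖)
    (hD : D.vec = M (capVec v)) (hE : E.vec = M (capVec w)) :
    v ≠ w ∧ -1 ≤ lorentz (capVec v) (capVec w) := by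
  obtain ⟨p, hp⟩ := h
  constructor
  · rintro rfl
    have hDE : D = E := Disk.vec_injective (hD.trans hE.symm)
    rw [hDE, Set.inter_self] at hp
    exact E.carrier_ne_singleton p hp
  · by_contra hlt
    have hmem : p ∈ D.carrier ∩ E.carrier := by rw [hp]; rfl
    rw [D.carrier_eq_region, E.carrier_eq_region, hD, hE, ← hM.image_region,
      ← hM.image_region, ← Set.image_inter μ.injective] at hmem
    obtain ⟨q, hq, -⟩ := hmem
    exact disjoint_region_capVec hv hw (not_le.1 hlt) q hq.1 hq.2

/-! ### Integrality and invariant lattices -/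

theorem IsInt.add {x y : ℝ} (hx : IsInt x) (hy : IsInt y) : IsInt (x + y) := by
  obtain ⟨m, rfl⟩ := hx
  obtain ⟨n, rfl⟩ := hy
  exact ⟨m + n, by push_cast; rfl⟩

theorem IsInt.neg {x : ℝ} (hx : IsInt x) : IsInt (-x) := by
  obtain ⟨m, rfl⟩ := hx
  exact ⟨-m, by push_cast; rfl⟩

theorem IsInt.sub {x y : ℝ} (hx : IsInt x) (hy : IsInt y) : IsInt (x - y) := by
  rw [sub_eq_add_neg]; exact hx.add hy.neg

theorem IsInt.mul {x y : ℝ} (hx : IsInt x) (hy : IsInt y) : IsInt (x * y) := by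
  obtain ⟨m, rfl⟩ := hx
  obtain ⟨n, rfl⟩ := hy
  exact ⟨m * n, by push_cast; rfl⟩

theorem isInt_intCast (m : ℤ) : IsInt m := ⟨m, rfl⟩

theorem isInt_abs_iff {x : ℝ} : IsInt |x| ↔ IsInt x := by
  rcases abs_choice x with h | h
  · rw [h]
  · rw [h]; exact ⟨fun hx => by simpa using hx.neg, IsInt.neg⟩

/-- With `m = 2 x`, the square `m² = 2 (2 x²)` is even, so `m` is even. -/
theorem isInt_of_two_mul {x : ℝ} (h : IsInt (2 * x)) (h' : IsInt (2 * x ^ 2)) : IsInt x := by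
  obtain ⟨m, hm⟩ := h
  obtain ⟨n, hn⟩ := h'
  have hmn : m ^ 2 = 2 * n := by
    have : (m : ℝ) ^ 2 = 2 * n := by rw [← hm, ← hn]; ring
    exact_mod_cast this
  have : (2 : ℤ) ∣ m := Int.prime_two.dvd_of_dvd_pow ⟨n, hmn⟩
  obtain ⟨k, rfl⟩ := this
  exact ⟨k, by push_cast at hm; linarith⟩

theorem isInt_of_mem_closure {S : Set Lor} {l : Lor →+ ℝ} (h : ∀ x ∈ S, IsInt (l x)) {x : Lor}
    (hx : x ∈ AddSubgroup.closure S) : IsInt (l x) := by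
  induction hx using AddSubgroup.closure_induction with
  | mem x hx => exact h x hx
  | zero => exact ⟨0, by simp⟩
  | add x y _ _ hx hy => rw [map_add]; exact hx.add hy
  | neg x _ hx => rw [map_neg]; exact hx.neg

/-- The Lorentz product with a fixed vector. -/
def lorentzRight (y : Lor) : Lor →+ ℝ where
  toFun x := lorentz x y
  map_zero' := lorentz_zero_left y
  map_add' a b := lorentz_add_left a b y

/-- An Apollonian packing is integral if the packing lies in a lattice of integral curvature that
contains, up to scaling, the dual disks as roots of norm two. -/
theorem integralDisks_of_generators {P : Set Space} (hP : IsEdgeScribed P)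
    {μ : Equiv.Perm ExtPlane} {M : Lor ≃ₗ[ℝ] Lor} (hM : Induces M μ) {S : Set Lor}
    (hv : ∀ v ∈ vertices P, M (capVec v) ∈ S) (hint : ∀ x ∈ S, IsInt (x 0))
    (hdual : ∀ f ∈ vertices (polar P), ∃ F ∈ AddSubgroup.closure S, lorentz F F = 2 ∧
      (∀ x ∈ S, IsInt (lorentz x F)) ∧ ∃ k : ℝ, 0 < k ∧ M (lift f 1) = k • F) :
    IntegralDisks (apollonianPacking P μ) := by
  rintro D ⟨g, hg, E, hE, hD⟩
  have hS : ∀ D ∈ dualPacking P μ, ∀ x ∈ AddSubgroup.closure S,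
      lorentzReflection D.vec x ∈ AddSubgroup.closure S := by
    rintro D ⟨D', ⟨f, hf, hD'⟩, hD⟩ x hx
    obtain ⟨F, hFS, hFF, hFint, k, hk, hMF⟩ := hdual f hf
    have h2 : (√2)⁻¹ * (√2)⁻¹ = 1 / 2 := by
      rw [← mul_inv, Real.mul_self_sqrt (by norm_num)]; norm_num
    -- The two factors `1 / √2` absorb the 2 of the reflection, which becomes `x ↦ x - ⟨x, F⟩ F`
    -- with an integral coefficient.
    have hvec : D.vec = (√2)⁻¹ • F := by
      refine Disk.vec_eq_of_carrier_eq ?_ ?_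
      · rw [lorentz_smul_left, lorentz_smul_right, hFF]; linarith
      · rw [hD, hD', stereo_image_illuminated, hM.image_region, hMF, region_smul hk,
          region_smul (by positivity)]
    obtain ⟨m, hm⟩ := isInt_of_mem_closure (l := lorentzRight F) hFint hx
    change lorentz x F = m at hm
    rw [lorentzReflection, hvec, lorentz_smul_right, hm, smul_smul,
      show 2 * ((√2)⁻¹ * (m : ℝ)) * (√2)⁻¹ = m by linear_combination (2 * (m : ℝ)) * h2,
      Int.cast_smul_eq_zsmul]
    exact sub_mem hx (zsmul_mem hFS m)
  obtain ⟨N, hN, hN'⟩ := exists_induces_preserving hS hg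
  obtain ⟨v, hvP, hEv⟩ := (mem_packing hP hM).1 hE
  have hDvec : D.vec = N E.vec := Disk.vec_eq_of_carrier_eq
    (by rw [hN.lorentz_map, E.lorentz_vec_self])
    (by rw [hD, E.carrier_eq_region, hN.image_region])
  have hmem : D.vec ∈ AddSubgroup.closure S := by
    rw [hDvec, hN', hEv]
    exact AddSubgroup.subset_closure (hv v hvP)
  rw [← D.vec_zero]
  exact isInt_of_mem_closure (l := Pi.evalAddMonoidHom (fun _ : Fin 4 => ℝ) 0) hint hmem

theorem lift_one_ne_zero (f : Space) : lift f 1 ≠ 0 := by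
  intro h
  have h0 := congrFun h 0
  have h3 := congrFun h 3
  simp [lift] at h0 h3
  linarith

theorem boolSign_mul_self (b : Bool) : boolSign b * boolSign b = 1 := by
  rw [← sq, boolSign_sq]

theorem boolSign_mul_of_ne {a b : Bool} (h : a ≠ b) : boolSign a * boolSign b = -1 := by
  cases a <;> cases b <;> simp_all [boolSign]

theorem sum_distinct (f : Fin 3 → ℝ) {a b c : Fin 3} (hab : a ≠ b) (hac : a ≠ c) (hbc : b ≠ c) :
    f 0 + f 1 + f 2 = f a + f b + f c := by
  fin_cases a <;> fin_cases b <;> fin_cases c <;> simp at hab hac hbc ⊢ <;> ring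

/-! ### The octahedron -/

theorem octahedron_eq : octahedron = convexHull ℝ (Set.range fun x : Fin 3 × Bool =>
    (EuclideanSpace.single x.1 (boolSign x.2) : Space)) := by
  rw [octahedron]
  congr 1
  ext x
  constructor
  · rintro ⟨i, rfl | rfl⟩
    · exact ⟨(i, true), by simp [boolSign]⟩
    · exact ⟨(i, false), by simp [boolSign]⟩
  · rintro ⟨⟨i, b⟩, rfl⟩
    refine ⟨i, ?_⟩
    cases b <;> simp [boolSign]

theorem inner_single_single (i j : Fin 3) (a b : ℝ) :
    inner ℝ (EuclideanSpace.single i a : Space) (EuclideanSpace.single j b) =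
      if i = j then a * b else 0 := by
  rw [EuclideanSpace.inner_single_left]
  by_cases h : i = j
  · simp [h]
  · simp [h]

theorem exists_octahedral_labelling {P : Set Space} (hP : IsEdgeScribed P)
    (hc : CombEquiv P octahedron) : ∃ p : Fin 3 → Bool → Space,
      (∀ i, p i true ≠ p i false) ∧ (∀ v, v ∈ vertices P ↔ ∃ i b, p i b = v) ∧
      ∀ i j b c, i ≠ j → lorentz (capVec (p i b)) (capVec (p j c)) = -1 := by
  rw [octahedron_eq] at hc
  obtain ⟨p, hinj, hrange, hface⟩ := hc.exists_labelling (by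
    rintro ⟨i, b⟩
    refine ⟨innerSL ℝ (EuclideanSpace.single i (boolSign b) : Space), ?_⟩
    rintro ⟨j, c⟩ hne
    simp only [innerSL_apply_apply, inner_single_single, if_true, boolSign_mul_self]
    split_ifs with h
    · subst h
      rw [boolSign_mul_of_ne fun h => hne (by rw [h])]
      norm_num
    · norm_num)
  have hmem : ∀ x, p x ∈ vertices P := fun x => hrange ▸ Set.mem_range_self x
  refine ⟨fun i b => p (i, b), fun i h => ?_, fun v => ?_, fun i j b c hij => ?_⟩
  · have := hinj h
    simp at this
  · rw [← hrange]; simp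
  · refine hP.lorentz_capVec_of_exposed (hmem _) (hmem _)
      (fun h => hij (congrArg Prod.fst (hinj h))) ?_
    -- The functional `± x i ± x j` is 1 at the two chosen vertices and at most 0 at the others.
    have := hface {(i, b), (j, c)} (innerSL ℝ (EuclideanSpace.single i (boolSign b)
      + EuclideanSpace.single j (boolSign c) : Space)) 1 ?_ ?_
    · rwa [Set.image_pair] at this
    · rintro x (rfl | rfl)
      · simp only [innerSL_apply_apply, inner_add_left, inner_single_single, if_true, hij.symm,
          if_false, boolSign_mul_self, add_zero]
      · simp only [innerSL_apply_apply, inner_add_left, inner_single_single, if_true, hij,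
          if_false, boolSign_mul_self, zero_add]
    · rintro ⟨k, d⟩ hk
      rw [innerSL_apply_apply, inner_add_left, inner_single_single, inner_single_single]
      have h1 : ¬(k = i ∧ d = b) := fun h => hk (Or.inl (by rw [h.1, h.2]))
      have h2 : ¬(k = j ∧ d = c) := fun h => hk (Or.inr (Prod.ext h.1 h.2))
      split_ifs with hik hjk hjk
      · exact absurd (hik.trans hjk.symm) hij
      · rw [boolSign_mul_of_ne fun h => h1 ⟨hik.symm, h.symm⟩]; norm_num
      · rw [boolSign_mul_of_ne fun h => h2 ⟨hjk.symm, h.symm⟩]; norm_num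
      · norm_num

theorem T₂_eq (a b c : ℝ) : 2 * T₂ a b c = (a + b + c) ^ 2 - (a ^ 2 + b ^ 2 + c ^ 2) := by
  simp [T₂, simplicialForm, Fin.sum_univ_three]

theorem C₂_eq (a b c : ℝ) : 2 * C₂ a b c =
    1 / 2 * ((a + c) ^ 2 - ((a - b) ^ 2 + (b - c) ^ 2)) := by
  have : Fin.last (1 + 1) = (2 : Fin 3) := rfl
  simp [C₂, hypercubicalForm, Fin.sum_univ_two, this]; ring

theorem octahedral_packing {P : Set Space} {μ : Equiv.Perm ExtPlane} (hP : IsEdgeScribed P)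
    (hc : CombEquiv P octahedron) (hμ : μ ∈ moebiusGroup) {b₁ b₂ b₃ : Disk}
    (h₁ : b₁ ∈ packing P μ) (h₂ : b₂ ∈ packing P μ) (h₃ : b₃ ∈ packing P μ) (h₁₂ : Tangent b₁ b₂)
    (h₂₃ : Tangent b₂ b₃) (h₁₃ : Tangent b₁ b₃) :
    0 ≤ T₂ b₁.curvature b₂.curvature b₃.curvature ∧
      (IntegralDisks (apollonianPacking P μ) ↔
        IsInt b₁.curvature ∧ IsInt b₂.curvature ∧ IsInt b₃.curvature ∧
          IsInt √(2 * T₂ b₁.curvature b₂.curvature b₃.curvature)) := by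
  obtain ⟨M, hM⟩ := exists_induces hμ
  obtain ⟨p, hpne, hp, hadj⟩ := exists_octahedral_labelling hP hc
  have hpv : ∀ i b, p i b ∈ vertices P := fun i b => (hp _).2 ⟨i, b, rfl⟩
  have hout : ∀ i b, 1 < ‖p i b‖ := fun i b => hP.outside _ (hpv i b)
  obtain ⟨e, w, hew, hu⟩ := exists_octahedral_frame (u := fun i b => capVec (p i b))
    (fun i b => lorentz_capVec_self (hout i b)) hadj
    (fun y hy => hP.eq_zero_of_lorentz_capVec fun v hv => by
      obtain ⟨i, b, rfl⟩ := (hp v).1 hv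
      exact hy i b)
    (fun i h => hpne i (eq_of_capVec_eq (hout i false) h))
  have hs2 : √2 * √2 = 2 := Real.mul_self_sqrt (by norm_num)
  have hlor : ∀ i b j c, lorentz (capVec (p i b)) (capVec (p j c)) =
      if i = j then -1 + boolSign b * boolSign c * 2 else -1 := by
    intro i b j c
    rw [hu, hu]
    simp only [lorentz_add_left, lorentz_add_right, lorentz_smul_left, lorentz_smul_right,
      hew.mixed, hew.mixed', hew.time, hew.space]
    split_ifs
    · linear_combination boolSign b * boolSign c * hs2
    · ring
  have hlw : ∀ i b, lorentz (capVec (p i b)) w = -1 := by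
    intro i b
    rw [hu, lorentz_add_left, lorentz_smul_left, hew.mixed, hew.time]; ring
  have hκ : ∀ i b, M (capVec (p i b)) 0 = M w 0 + boolSign b * √2 * M (e i) 0 := by
    intro i b
    rw [hu, map_add, map_smul]; rfl
  have hdist : ∀ {D E : Disk} {i j : Fin 3} {b c : Bool}, Tangent D E →
      D.vec = M (capVec (p i b)) → E.vec = M (capVec (p j c)) → i ≠ j := by
    rintro D E i j b c hDE hD hE rfl
    obtain ⟨h1, h2⟩ := hDE.lorentz_ge hM (hout _ _) (hout _ _) hD hE
    rw [hlor, if_pos rfl, boolSign_mul_of_ne fun h => h1 (by rw [h])] at h2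
    norm_num at h2
  obtain ⟨v₁, hv₁, hD₁⟩ := (mem_packing hP hM).1 h₁
  obtain ⟨v₂, hv₂, hD₂⟩ := (mem_packing hP hM).1 h₂
  obtain ⟨v₃, hv₃, hD₃⟩ := (mem_packing hP hM).1 h₃
  obtain ⟨i, s, rfl⟩ := (hp v₁).1 hv₁
  obtain ⟨j, t, rfl⟩ := (hp v₂).1 hv₂
  obtain ⟨k, r, rfl⟩ := (hp v₃).1 hv₃
  have hij := hdist h₁₂ hD₁ hD₂
  have hjk := hdist h₂₃ hD₂ hD₃
  have hik := hdist h₁₃ hD₁ hD₃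
  have hk₁ : b₁.curvature = M w 0 + boolSign s * √2 * M (e i) 0 := by
    rw [← b₁.vec_zero, hD₁, hκ]
  have hk₂ : b₂.curvature = M w 0 + boolSign t * √2 * M (e j) 0 := by
    rw [← b₂.vec_zero, hD₂, hκ]
  have hk₃ : b₃.curvature = M w 0 + boolSign r * √2 * M (e k) 0 := by
    rw [← b₃.vec_zero, hD₃, hκ]
  -- Isotropy reads `∑ (κ - W)² = 2 W²` over the three curvatures, with `W = M w 0`; completing the
  -- square in `W` gives the claim.
  have hT : 2 * T₂ b₁.curvature b₂.curvature b₃.curvature =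
      (M w 0 - (b₁.curvature + b₂.curvature + b₃.curvature)) ^ 2 := by
    have hnull := (hew.map hM.lorentz_map).sum_curvature_sq
    rw [sum_distinct (fun m => M (e m) 0 ^ 2) hij hik hjk] at hnull
    have hk : (b₁.curvature - M w 0) ^ 2 + (b₂.curvature - M w 0) ^ 2
        + (b₃.curvature - M w 0) ^ 2 = 2 * M w 0 ^ 2 := by
      have hs := boolSign_sq s
      have ht := boolSign_sq t
      have hr := boolSign_sq r
      rw [hk₁, hk₂, hk₃]
      linear_combination 2 * hnull + M (e i) 0 ^ 2 * (2 * hs + boolSign s ^ 2 * hs2)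
        + M (e j) 0 ^ 2 * (2 * ht + boolSign t ^ 2 * hs2)
        + M (e k) 0 ^ 2 * (2 * hr + boolSign r ^ 2 * hs2)
    rw [T₂_eq]
    linear_combination -hk
  refine ⟨by nlinarith [sq_nonneg (M w 0 - (b₁.curvature + b₂.curvature + b₃.curvature))], ?_⟩
  rw [hT, Real.sqrt_sq_eq_abs, isInt_abs_iff]
  constructor
  · intro hint
    have hi₁ := hint _ (packing_subset_apollonianPacking P μ h₁)
    have hi₂ := hint _ (packing_subset_apollonianPacking P μ h₂)
    have hi₃ := hint _ (packing_subset_apollonianPacking P μ h₃)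
    refine ⟨hi₁, hi₂, hi₃, isInt_of_two_mul ?_ ?_⟩
    -- The disk opposite to `b₁` has curvature `2 W - κ₁`.
    · obtain ⟨D, hD, hDκ⟩ := exists_mem_packing hP hM (hpv i (!s))
      have hiD := hint _ (packing_subset_apollonianPacking P μ hD)
      have h2w : D.curvature = 2 * M w 0 - b₁.curvature := by
        rw [hDκ, hκ, hk₁, boolSign_not]; ring
      have := (hiD.add hi₁).sub ((isInt_intCast 2).mul ((hi₁.add hi₂).add hi₃))
      convert this using 1
      rw [h2w]; push_cast; ring
    · rw [← hT, T₂_eq]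
      have := (isInt_intCast 4).mul (((hi₁.mul hi₂).add (hi₂.mul hi₃)).add (hi₁.mul hi₃))
      convert this using 1
      push_cast; ring
  · rintro ⟨hi₁, hi₂, hi₃, hiW⟩
    have hW : IsInt (M w 0) := by
      have := hiW.add ((hi₁.add hi₂).add hi₃)
      rwa [sub_add_cancel] at this
    have hone : ∀ {κ : ℝ} {a : Fin 3} {b : Bool}, IsInt κ →
        κ = M w 0 + boolSign b * √2 * M (e a) 0 → ∀ c, IsInt (M (capVec (p a c)) 0) := by
      intro κ a b hκi hκe c
      rw [hκ]
      by_cases hcb : c = b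
      · rw [hcb, ← hκe]; exact hκi
      · have hcb' : c = !b := by cases b <;> cases c <;> simp_all
        have := ((isInt_intCast 2).mul hW).sub hκi
        convert this using 1
        rw [hκe, hcb', boolSign_not]; push_cast; ring
    have hall : ∀ a c, IsInt (M (capVec (p a c)) 0) := by
      intro a c
      obtain rfl | rfl | rfl : a = i ∨ a = j ∨ a = k := by omega
      · exact hone hi₁ hk₁ c
      · exact hone hi₂ hk₂ c
      · exact hone hi₃ hk₃ c
    refine integralDisks_of_generators hP hM
      (S := insert (M w) (Set.range fun x : Fin 3 × Bool => M (capVec (p x.1 x.2)))) ?_ ?_ ?_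
    · intro v hv
      obtain ⟨a, c, rfl⟩ := (hp v).1 hv
      exact Or.inr ⟨(a, c), rfl⟩
    · rintro _ (rfl | ⟨x, rfl⟩)
      · exact hW
      · exact hall _ _
    · intro f hf
      obtain ⟨hle, hrank⟩ := hP.polar_vertex_lorentz hf
      obtain ⟨σ, m, hm, hF⟩ := octahedral_dual hew hu (lift_one_ne_zero f) (fun a c => hle _ (hpv a c))
        (fun z hz => hrank z fun v hv hv0 => by
          obtain ⟨a, c, rfl⟩ := (hp v).1 hv
          exact hz a c hv0)
      -- The dual vector involves `w` itself, which is why `M w` is among the generators.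
      refine ⟨M (capVec (p 0 (σ 0)) + capVec (p 1 (σ 1)) + capVec (p 2 (σ 2)) - w), ?_, ?_, ?_,
        m, hm, ?_⟩
      · have hmem : ∀ a c, M (capVec (p a c)) ∈ AddSubgroup.closure
            (insert (M w) (Set.range fun x : Fin 3 × Bool => M (capVec (p x.1 x.2)))) :=
          fun a c => AddSubgroup.subset_closure (Or.inr ⟨(a, c), rfl⟩)
        rw [map_sub, map_add, map_add]
        exact sub_mem (add_mem (add_mem (hmem _ _) (hmem _ _)) (hmem _ _))
          (AddSubgroup.subset_closure (Or.inl rfl))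
      · rw [hM.lorentz_map]
        simp only [lorentz_add_left, lorentz_add_right, lorentz_sub_left, lorentz_sub_right, hlor,
          hlw, lorentz_comm w (capVec _), hew.time, boolSign_mul_self]
        simp
        norm_num
      · have hww : lorentz w (capVec (p 0 (σ 0)) + capVec (p 1 (σ 1)) + capVec (p 2 (σ 2)) - w)
            = (-2 : ℤ) := by
          simp only [lorentz_add_right, lorentz_sub_right, lorentz_comm w (capVec _), hlw, hew.time]
          norm_num
        rintro _ (rfl | ⟨⟨a, c⟩, rfl⟩)
        · rw [hM.lorentz_map, hww]
          exact isInt_intCast _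
        · have hbb : ∀ b c, IsInt (boolSign b * boolSign c) := by
            intro b c
            by_cases h : b = c
            · rw [h, boolSign_mul_self]; exact ⟨1, by simp⟩
            · rw [boolSign_mul_of_ne h]; exact ⟨-1, by simp⟩
          have hint' : ∀ a b c d, IsInt (lorentz (capVec (p a b)) (capVec (p c d))) := by
            intro a b c d
            rw [hlor]
            split_ifs
            · exact IsInt.add ⟨-1, by simp⟩ ((hbb _ _).mul ⟨2, by simp⟩)
            · exact ⟨-1, by simp⟩
          rw [hM.lorentz_map]
          simp only [lorentz_add_right, lorentz_sub_right, hlw]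
          exact (((hint' _ _ _ _).add (hint' _ _ _ _)).add (hint' _ _ _ _)).sub ⟨-1, by simp⟩
      · rw [hF, map_smul]

/-! ### The cube -/

theorem exists_third : ∀ a b : Fin 3, ∃ c, a ≠ c ∧ b ≠ c := by decide

/-- The vertex of the cube with given signs. -/
def cubeVertex (s : Fin 3 → Bool) : Space := WithLp.toLp 2 fun i => boolSign (s i)

theorem cube_eq : cube = convexHull ℝ (Set.range cubeVertex) := by
  rw [cube]
  congr 1
  ext x
  constructor
  · intro hx
    have : ∀ i, ∃ b, boolSign b = x i := by
      intro i
      rcases hx i with h | h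
      · exact ⟨true, by simp [boolSign, h]⟩
      · exact ⟨false, by simp [boolSign, h]⟩
    choose s hs using this
    refine ⟨s, ?_⟩
    ext i
    exact hs i
  · rintro ⟨s, rfl⟩ i
    change boolSign (s i) = 1 ∨ boolSign (s i) = -1
    cases s i <;> simp [boolSign]

/-- The faces of the cube are obtained by fixing some of the signs. -/
theorem exists_cube_functional (I : Finset (Fin 3)) (s : Fin 3 → Bool) :
    ∃ (l : Space →L[ℝ] ℝ) (c : ℝ), (∀ t, (∀ i ∈ I, t i = s i) → l (cubeVertex t) = c) ∧
      ∀ t, ¬(∀ i ∈ I, t i = s i) → l (cubeVertex t) < c := by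
  have hl : ∀ t, innerSL ℝ (∑ i ∈ I, EuclideanSpace.single i (boolSign (s i)) : Space)
      (cubeVertex t) = ∑ i ∈ I, boolSign (s i) * boolSign (t i) := by
    intro t
    rw [innerSL_apply_apply, sum_inner]
    refine Finset.sum_congr rfl fun i _ => ?_
    rw [EuclideanSpace.inner_single_left]
    rfl
  refine ⟨innerSL ℝ (∑ i ∈ I, EuclideanSpace.single i (boolSign (s i)) : Space),
    ∑ i ∈ I, 1, fun t ht => ?_, fun t ht => ?_⟩
  · rw [hl]
    exact Finset.sum_congr rfl fun i hi => by rw [ht i hi, boolSign_mul_self]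
  · rw [hl]
    push Not at ht
    obtain ⟨i, hi, hne⟩ := ht
    refine Finset.sum_lt_sum (fun j _ => ?_) ⟨i, hi, ?_⟩
    · by_cases h : s j = t j
      · rw [h, boolSign_mul_self]
      · rw [boolSign_mul_of_ne h]; norm_num
    · rw [boolSign_mul_of_ne hne.symm]; norm_num

theorem exists_cubical_labelling {P : Set Space} (hP : IsEdgeScribed P)
    (hc : CombEquiv P cube) : ∃ p : (Fin 3 → Bool) → Space,
      (∀ v, v ∈ vertices P ↔ ∃ s, p s = v) ∧
      (∀ s a, lorentz (capVec (p s)) (capVec (p (Function.update s a (!s a)))) = -1) ∧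
      ∀ a b, ∃ y, (∀ s, s a = b → lorentz y (capVec (p s)) = 0) ∧
        ∀ s, s a ≠ b → lorentz y (capVec (p s)) < 0 := by
  rw [cube_eq] at hc
  obtain ⟨p, hinj, hrange, hface⟩ := hc.exists_labelling (by
    intro s
    obtain ⟨l, c, h1, h2⟩ := exists_cube_functional Finset.univ s
    refine ⟨l, fun t hts => ?_⟩
    rw [h1 s fun _ _ => rfl]
    exact h2 t fun h => hts (funext fun i => h i (Finset.mem_univ i)))
  have hexp : ∀ (I : Finset (Fin 3)) (s : Fin 3 → Bool), IsExposed ℝ P (convexHull ℝ (p '' {t | ∀ i ∈ I, t i = s i})) := by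
    intro I s
    obtain ⟨l, c, h1, h2⟩ := exists_cube_functional I s
    exact hface _ l c h1 h2
  have hmem : ∀ x, p x ∈ vertices P := fun x => hrange ▸ Set.mem_range_self x
  refine ⟨p, fun v => by rw [← hrange]; rfl, fun s a => ?_, fun a b => ?_⟩
  · refine hP.lorentz_capVec_of_exposed (hmem _) (hmem _) (fun h => ?_) ?_
    · have := congrFun (hinj h) a
      simp at this
    -- Fixing every sign except the one at `a` cuts out an edge.
    · have := hexp {a}ᶜ s
      have hset : {t : Fin 3 → Bool | ∀ i ∈ ({a}ᶜ : Finset (Fin 3)), t i = s i}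
          = {s, Function.update s a (!s a)} := by
        ext t
        simp only [Finset.mem_compl, Finset.mem_singleton, Set.mem_ofPred_eq, Set.mem_insert_iff,
          Set.mem_singleton_iff]
        constructor
        · intro ht
          by_cases hta : t a = s a
          · left; ext i
            by_cases hi : i = a
            · rw [hi, hta]
            · rw [ht i hi]
          · right; ext i
            by_cases hi : i = a
            · subst hi
              rw [Function.update_self]
              revert hta
              cases t i <;> cases s i <;> simp
            · rw [ht i hi, Function.update_of_ne hi]
        · rintro (rfl | rfl) i hi
          · rfl
          · rw [Function.update_of_ne hi]
      rwa [hset, Set.image_pair] at this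
  · have := hexp {a} fun _ => b
    obtain ⟨y, hy, hy'⟩ := hP.exists_lorentz_face
      (T := p '' {t | ∀ i ∈ ({a} : Finset (Fin 3)), t i = b})
      ⟨p fun _ => b, fun _ => b, fun _ _ => rfl, rfl⟩ this
    refine ⟨y, fun s hs => hy _ ⟨s, by simpa using hs, rfl⟩, fun s hs => hy' _ (hmem s) ?_⟩
    rintro ⟨t, ht, hts⟩
    rw [← hinj hts] at hs
    exact hs (ht a (by simp))

theorem cubical_packing {P : Set Space} {μ : Equiv.Perm ExtPlane} (hP : IsEdgeScribed P)
    (hc : CombEquiv P cube) (hμ : μ ∈ moebiusGroup) {b₁ b₂ b₃ : Disk}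
    (h₁ : b₁ ∈ packing P μ) (h₂ : b₂ ∈ packing P μ) (h₃ : b₃ ∈ packing P μ) (hne : b₁ ≠ b₃)
    (h₁₂ : Tangent b₁ b₂) (h₂₃ : Tangent b₂ b₃) :
    0 ≤ C₂ b₁.curvature b₂.curvature b₃.curvature ∧
      (IntegralDisks (apollonianPacking P μ) ↔
        IsInt b₁.curvature ∧ IsInt b₂.curvature ∧ IsInt b₃.curvature ∧
          IsInt √(2 * C₂ b₁.curvature b₂.curvature b₃.curvature)) := by
  obtain ⟨M, hM⟩ := exists_induces hμ
  obtain ⟨p, hp, hadj, hface⟩ := exists_cubical_labelling hP hc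
  have hpv : ∀ s, p s ∈ vertices P := fun s => (hp _).2 ⟨s, rfl⟩
  have hout : ∀ s, 1 < ‖p s‖ := fun s => hP.outside _ (hpv s)
  obtain ⟨e, w, hew, hu⟩ := exists_cubical_frame (c := fun s => capVec (p s))
    (fun s => lorentz_capVec_self (hout s)) hadj hface
  have hs2 : √2 * √2 = 2 := Real.mul_self_sqrt (by norm_num)
  have hlor : ∀ s t, lorentz (capVec (p s)) (capVec (p t)) =
      -2 + (boolSign (s 0) * boolSign (t 0) + boolSign (s 1) * boolSign (t 1)
        + boolSign (s 2) * boolSign (t 2)) := by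
    intro s t
    rw [hu, hu]
    simp only [lorentz_add_left, lorentz_add_right, lorentz_smul_left, lorentz_smul_right,
      hew.mixed, hew.mixed', hew.time, hew.space]
    simp
    ring
  have hκ : ∀ s, M (capVec (p s)) 0 = √2 * M w 0 + (boolSign (s 0) * M (e 0) 0
      + boolSign (s 1) * M (e 1) 0 + boolSign (s 2) * M (e 2) 0) := by
    intro s
    rw [hu]
    simp only [map_add, map_smul]
    rfl
  have hdist : ∀ {D E : Disk} {s t : Fin 3 → Bool}, Tangent D E →
      D.vec = M (capVec (p s)) → E.vec = M (capVec (p t)) →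
        ∃ a, s a = !t a ∧ ∀ i, i ≠ a → s i = t i := by
    intro D E s t hDE hD hE
    obtain ⟨h1, h2⟩ := hDE.lorentz_ge hM (hout _) (hout _) hD hE
    rw [hlor] at h2
    by_contra! hcon
    have hst : s ≠ t := fun h => h1 (by rw [h])
    obtain ⟨a, ha⟩ := Function.ne_iff.1 hst
    obtain ⟨b, hba, hb⟩ := hcon a (by revert ha; cases s a <;> cases t a <;> simp)
    obtain ⟨c, hac, hbc⟩ := exists_third a b
    rw [sum_distinct (fun i => boolSign (s i) * boolSign (t i)) hba.symm hac hbc,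
      boolSign_mul_of_ne ha, boolSign_mul_of_ne hb] at h2
    by_cases hsc : s c = t c
    · rw [hsc, boolSign_mul_self] at h2; norm_num at h2
    · rw [boolSign_mul_of_ne hsc] at h2; norm_num at h2
  obtain ⟨v₁, hv₁, hD₁⟩ := (mem_packing hP hM).1 h₁
  obtain ⟨v₂, hv₂, hD₂⟩ := (mem_packing hP hM).1 h₂
  obtain ⟨v₃, hv₃, hD₃⟩ := (mem_packing hP hM).1 h₃
  obtain ⟨s, rfl⟩ := (hp v₁).1 hv₁
  obtain ⟨t, rfl⟩ := (hp v₂).1 hv₂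
  obtain ⟨r, rfl⟩ := (hp v₃).1 hv₃
  obtain ⟨a, hsa, hsi⟩ := hdist h₁₂ hD₁ hD₂
  obtain ⟨b, htb, hti⟩ := hdist h₂₃ hD₂ hD₃
  have hab : a ≠ b := by
    rintro rfl
    refine hne (Disk.vec_injective ?_)
    rw [hD₁, hD₃]
    congr 3
    ext i
    by_cases hi : i = a
    · rw [hi, hsa, htb, Bool.not_not]
    · rw [hsi i hi, hti i hi]
  obtain ⟨c, hac, hbc⟩ := exists_third a b
  obtain ⟨W, hW⟩ : ∃ W, W = √2 * M w 0 := ⟨_, rfl⟩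
  -- Signs are measured relative to the middle vertex `t`, so that `b₂` has curvature `W + ε a + ε b
  -- + ε c`.
  obtain ⟨ε, hε⟩ : ∃ ε : Fin 3 → ℝ, ∀ i, ε i = boolSign (t i) * M (e i) 0 := ⟨_, fun _ => rfl⟩
  have hκ' : ∀ s', M (capVec (p s')) 0 = W + (boolSign (s' a) * boolSign (t a) * ε a
      + boolSign (s' b) * boolSign (t b) * ε b + boolSign (s' c) * boolSign (t c) * ε c) := by
    intro s'
    rw [hκ, sum_distinct (fun i => boolSign (s' i) * M (e i) 0) hab hac hbc, hW, hε, hε, hε]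
    linear_combination (-boolSign (s' a) * M (e a) 0) * boolSign_sq (t a)
      - boolSign (s' b) * M (e b) 0 * boolSign_sq (t b)
      - boolSign (s' c) * M (e c) 0 * boolSign_sq (t c)
  have hk₁ : b₁.curvature = W - ε a + ε b + ε c := by
    rw [← b₁.vec_zero, hD₁, hκ', hsa, hsi b hab.symm, hsi c hac.symm, boolSign_not, neg_mul,
      boolSign_mul_self, boolSign_mul_self, boolSign_mul_self]
    ring
  have hk₂ : b₂.curvature = W + ε a + ε b + ε c := by
    rw [← b₂.vec_zero, hD₂, hκ', boolSign_mul_self, boolSign_mul_self, boolSign_mul_self]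
    ring
  have hk₃ : b₃.curvature = W + ε a - ε b + ε c := by
    rw [← b₃.vec_zero, hD₃, hκ', ← hti a hab, ← hti c hbc.symm, htb, boolSign_not, mul_neg,
      boolSign_mul_self, boolSign_mul_self, boolSign_mul_self]
    ring
  have hC : 2 * C₂ b₁.curvature b₂.curvature b₃.curvature =
      (W - (b₁.curvature + b₃.curvature)) ^ 2 := by
    have hnull := (hew.map hM.lorentz_map).sum_curvature_sq
    rw [sum_distinct (fun m => M (e m) 0 ^ 2) hab hac hbc] at hnull
    have hnull' : ε a ^ 2 + ε b ^ 2 + ε c ^ 2 = W ^ 2 / 2 := by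
      rw [hε, hε, hε, hW]
      linear_combination hnull + M (e a) 0 ^ 2 * boolSign_sq (t a)
        + M (e b) 0 ^ 2 * boolSign_sq (t b) + M (e c) 0 ^ 2 * boolSign_sq (t c)
        - M w 0 ^ 2 / 2 * hs2
    rw [C₂_eq, hk₁, hk₂, hk₃]
    linear_combination -2 * hnull'
  refine ⟨by nlinarith [sq_nonneg (W - (b₁.curvature + b₃.curvature))], ?_⟩
  rw [hC, Real.sqrt_sq_eq_abs, isInt_abs_iff]
  constructor
  · intro hint
    have hi₁ := hint _ (packing_subset_apollonianPacking P μ h₁)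
    have hi₂ := hint _ (packing_subset_apollonianPacking P μ h₂)
    have hi₃ := hint _ (packing_subset_apollonianPacking P μ h₃)
    refine ⟨hi₁, hi₂, hi₃, isInt_of_two_mul ?_ ?_⟩
    -- The disk opposite to `b₂` has curvature `2 W - κ₂`.
    · obtain ⟨D, hD, hDκ⟩ := exists_mem_packing hP hM (hpv fun i => !t i)
      have hiD := hint _ (packing_subset_apollonianPacking P μ hD)
      have h2w : D.curvature = 2 * W - b₂.curvature := by
        rw [hDκ, hκ', hk₂]
        simp only [boolSign_not, neg_mul, boolSign_mul_self]
        ring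
      have := (hiD.add hi₂).sub ((isInt_intCast 2).mul (hi₁.add hi₃))
      convert this using 1
      rw [h2w]; push_cast; ring
    · rw [← hC, C₂_eq]
      have h13 := hi₁.add hi₃
      have h12 := hi₁.sub hi₂
      have h23 := hi₂.sub hi₃
      have := (h13.mul h13).sub ((h12.mul h12).add (h23.mul h23))
      convert this using 1
      ring
  · rintro ⟨hi₁, hi₂, hi₃, hiW⟩
    have hWi : IsInt W := by
      have := hiW.add (hi₁.add hi₃)
      rwa [sub_add_cancel] at this
    have hsign : ∀ x y, boolSign x * boolSign y = 1 ∨ boolSign x * boolSign y = -1 := by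
      intro x y
      by_cases h : x = y
      · left; rw [h, boolSign_mul_self]
      · right; rw [boolSign_mul_of_ne h]
    have hall : ∀ s', IsInt (M (capVec (p s')) 0) := by
      have h2W := hWi.add hWi
      -- Curvature of the fourth disk on the face of `b₁, b₂, b₃`; the other four disks are opposite
      -- to these, with curvatures `2 W - κ`.
      have hi₄ := (hi₁.add hi₃).sub hi₂
      intro s'
      rw [hκ']
      rcases hsign (s' a) (t a) with h | h <;> rcases hsign (s' b) (t b) with h' | h' <;>
        rcases hsign (s' c) (t c) with h'' | h'' <;> rw [h, h', h'']
      · convert hi₂ using 1; rw [hk₂]; ring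
      · convert h2W.sub hi₄ using 1; rw [hk₁, hk₂, hk₃]; ring
      · convert hi₃ using 1; rw [hk₃]; ring
      · convert h2W.sub hi₁ using 1; rw [hk₁]; ring
      · convert hi₁ using 1; rw [hk₁]; ring
      · convert h2W.sub hi₃ using 1; rw [hk₃]; ring
      · convert hi₄ using 1; rw [hk₁, hk₂, hk₃]; ring
      · convert h2W.sub hi₂ using 1; rw [hk₂]; ring
    have hWM : M (√2 • w) 0 = W := by rw [map_smul, hW]; rfl
    refine integralDisks_of_generators hP hM
      (S := insert (M (√2 • w)) (Set.range fun x : Fin 3 → Bool => M (capVec (p x)))) ?_ ?_ ?_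
    · intro v hv
      obtain ⟨s', rfl⟩ := (hp v).1 hv
      exact Or.inr ⟨s', rfl⟩
    · rintro _ (rfl | ⟨x, rfl⟩)
      · rw [hWM]; exact hWi
      · exact hall _
    · intro f hf
      obtain ⟨hle, hrank⟩ := hP.polar_vertex_lorentz hf
      obtain ⟨i, x, m, hm, hF⟩ := cubical_dual hew hu (lift_one_ne_zero f)
        (fun s' => hle _ (hpv s'))
        (fun z hz => hrank z fun v hv hv0 => by
          obtain ⟨s', rfl⟩ := (hp v).1 hv
          exact hz s' hv0)
      refine ⟨M (√2 • w + (2 * boolSign x) • e i), ?_, ?_, ?_, m, hm, ?_⟩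
      -- The difference of two adjacent vertices is twice a frame vector, so the root lies in the
      -- lattice.
      · have hdiff : (2 * boolSign x) • e i = capVec (p fun _ => x)
            - capVec (p (Function.update (fun _ => x) i (!x))) := by
          rw [hu, hu]
          obtain rfl | rfl | rfl : i = 0 ∨ i = 1 ∨ i = 2 := by omega
          all_goals
            simp [boolSign_not]
            module
        have hmem : ∀ s', M (capVec (p s')) ∈ AddSubgroup.closure
            (insert (M (√2 • w)) (Set.range fun x : Fin 3 → Bool => M (capVec (p x)))) :=
          fun s' => AddSubgroup.subset_closure (Or.inr ⟨s', rfl⟩)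
        rw [hdiff, map_add, map_sub]
        exact add_mem (AddSubgroup.subset_closure (Or.inl rfl)) (sub_mem (hmem _) (hmem _))
      · rw [hM.lorentz_map]
        simp only [lorentz_add_left, lorentz_add_right, lorentz_smul_left, lorentz_smul_right,
          hew.mixed, hew.mixed', hew.time, hew.space, if_true]
        linear_combination -hs2 + 4 * boolSign_sq x
      · rintro _ (rfl | ⟨s', rfl⟩)
        · refine ⟨-2, ?_⟩
          rw [hM.lorentz_map]
          simp only [lorentz_add_right, lorentz_smul_left, lorentz_smul_right,
            hew.mixed', hew.time]
          push_cast
          linear_combination -hs2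
        · have : lorentz (capVec (p s')) (√2 • w + (2 * boolSign x) • e i)
              = -2 + 2 * (boolSign (s' i) * boolSign x) := by
            rw [hu]
            simp only [lorentz_add_left, lorentz_add_right, lorentz_smul_left, lorentz_smul_right,
              hew.mixed, hew.mixed', hew.time, hew.space]
            obtain rfl | rfl | rfl : i = 0 ∨ i = 1 ∨ i = 2 := by omega
            all_goals
              simp
              ring
          rw [hM.lorentz_map, this]
          rcases hsign (s' i) x with h | h <;> rw [h]
          · exact ⟨0, by norm_num⟩
          · exact ⟨-4, by norm_num⟩
      · rw [hF, map_smul]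

end ApollonianPacking

end

theorem mainTheorem11 :
    (∀ (P : Set Space) (μ : Equiv.Perm ExtPlane), IsEdgeScribed P → CombEquiv P octahedron →
      μ ∈ moebiusGroup →
      ∀ b₁ ∈ packing P μ, ∀ b₂ ∈ packing P μ, ∀ b₃ ∈ packing P μ,
        Tangent b₁ b₂ → Tangent b₂ b₃ → Tangent b₁ b₃ →
        0 ≤ T₂ b₁.curvature b₂.curvature b₃.curvature ∧
        (IntegralDisks (apollonianPacking P μ) ↔
          IsInt b₁.curvature ∧ IsInt b₂.curvature ∧ IsInt b₃.curvature ∧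
          IsInt √(2 * T₂ b₁.curvature b₂.curvature b₃.curvature))) ∧
    (∀ (P : Set Space) (μ : Equiv.Perm ExtPlane), IsEdgeScribed P → CombEquiv P cube →
      μ ∈ moebiusGroup →
      ∀ b₁ ∈ packing P μ, ∀ b₂ ∈ packing P μ, ∀ b₃ ∈ packing P μ,
        b₁ ≠ b₃ → Tangent b₁ b₂ → Tangent b₂ b₃ →
        0 ≤ C₂ b₁.curvature b₂.curvature b₃.curvature ∧
        (IntegralDisks (apollonianPacking P μ) ↔
          IsInt b₁.curvature ∧ IsInt b₂.curvature ∧ IsInt b₃.curvature ∧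
          IsInt √(2 * C₂ b₁.curvature b₂.curvature b₃.curvature))) :=
  ⟨fun _ _ hP hc hμ _ h₁ _ h₂ _ h₃ h₁₂ h₂₃ h₁₃ => octahedral_packing hP hc hμ h₁ h₂ h₃ h₁₂ h₂₃ h₁₃,
    fun _ _ hP hc hμ _ h₁ _ h₂ _ h₃ hne h₁₂ h₂₃ => cubical_packing hP hc hμ h₁ h₂ h₃ hne h₁₂ h₂₃⟩
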